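/- **Setting.** Let $\mathscr G$ be an ample groupoid: a topological groupoid (a small category of isomorphisms with continuous multiplication and inversion) whose unit space $\mathscr G^{(0)}$, with the subspace topology, is locally compact Hausdorff with a basis of compact open sets and whose range map $r:\mathscr G\to\mathscr G^{(0)}$ is a local homeomorphism; $d$ denotes the domain map. Neither $\mathscr G$ nor the total spaces below need be Hausdorff. A *$\mathscr G$-sheaf of rings* $\mathcal O$ is a topological space $E$ with a local homeomorphism $p:E\to\mathscr G^{(0)}$, a unital ring structure on each stalk $\mathcal O_x=p^{-1}(x)$, and unital ring homomorphisms $\alpha_\gamma:\mathcal O_{d(\gamma)}\to\mathcal O_{r(\gamma)}$ ($\gamma\in\mathscr G$) such that $\alpha_x=\mathrm{id}$ for units $x$, $\alpha_{\beta\gamma}=\alpha_\beta\alpha_\gamma$ whenever $d(\beta)=r(\gamma)$, and such that the maps $(\gamma,e)\mapsto\alpha_\gamma(e)$ on $\mathscr G\times_{d,p}E$, fibrewise addition and multiplication $E\times_{p,p}E\to E$, and $x\mapsto 1_x$ are continuous. A *$\mathscr G$-sheaf of $\mathcal O$-modules* $\mathcal M$ is likewise a space $F$ with a local homeomorphism $q:F\to\mathscr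 G^{(0)}$, a unital left $\mathcal O_x$-module structure on each stalk $\mathcal M_x=q^{-1}(x)$, and additive maps $\beta_\gamma:\mathcal M_{d(\gamma)}\to\mathcal M_{r(\gamma)}$, functorial in $\gamma$ as above, with $\beta_\gamma(am)=\alpha_\gamma(a)\beta_\gamma(m)$, such that $(\gamma,m)\mapsto\beta_\gamma(m)$, fibrewise addition $F\times_{q,q}F\to F$ and scalar multiplication $E\times_{p,q}F\to F$ are continuous. A *compact open bisection* is a compact open $U\subseteq\mathscr G$ on which $d$ and $r$ are injective. Let $\Gamma_c(\mathscr G,\mathcal O)$ be the additive group generated by the maps $f:\mathscr G\to E$ with $p\circ f=r$ for which there is a compact open bisection $U$ such that $f|_U$ is continuous and $f=0$ off $U$; it is a ring under the convolution $(f*g)(\gamma)=\sum_{\beta\rho=\gamma}f(\beta)\,\alpha_\beta(g(\rho))$. Let $\Gamma_c(\mathscr G,\mathcal M)$ be the group of continuous sections $s:\mathscr G^{(0)}\to F$ of $q$ with compact support, a left $\Gamma_c(\mathscr G,\mathcal O)$-module via $(fs)(x)=\sum_{r(\gamma)=x}f(\gamma)\,\beta_\gamma(s(d(\gamma)))$.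 For $x\in\mathscr G^{(0)}$ let $\mathscr G_x^x=\{\gamma : d(\gamma)=r(\gamma)=x\}$, let $B_x=\mathcal O_x\rtimes\mathscr G_x^x$ be the skew group ring (product $b\delta\cdot c\eta=b\,\alpha_\delta(c)\,\delta\eta$), and let $\mathcal L_x=\bigoplus_{d(\gamma)=x}\mathcal O_{r(\gamma)}$, where $a1_\gamma$ denotes $a\in\mathcal O_{r(\gamma)}$ placed in the coordinate $\gamma$. It is a $\Gamma_c(\mathscr G,\mathcal O)$-$B_x$-bimodule via $$f\cdot a1_\gamma=\sum_{d(\beta)=r(\gamma)}f(\beta)\,\alpha_\beta(a)\,1_{\beta\gamma},\qquad a1_\gamma\cdot b\delta=a\,\alpha_\gamma(b)\,1_{\gamma\delta}.$$ For a left $B_x$-module $N$ put $\mathrm{Ind}_x(N)=\mathcal L_x\otimes_{B_x}N$, a left $\Gamma_c(\mathscr G,\mathcal O)$-module. The stalk $\mathcal M_x$ is a left $B_x$-module via $b\delta\cdot m=b\,\beta_\delta(m)$. $\mathrm{Ann}$ denotes the annihilator in $\Gamma_c(\mathscr G,\mathcal O)$. **Theorem.** Let $\mathscr G$ be an ample groupoid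 and $\mathcal O$ a $\mathscr G$-sheaf of rings. 1. For every $\mathscr G$-sheaf $\mathcal M$ of $\mathcal O$-modules, $$\mathrm{Ann}(\Gamma_c(\mathscr G,\mathcal M))=\bigcap_{x\in\mathscr G^{(0)}}\mathrm{Ann}(\mathrm{Ind}_x(\mathcal M_x)).$$ 2. Consequently, every two-sided ideal of $\Gamma_c(\mathscr G,\mathcal O)$ is an intersection of annihilators of induced modules: for every two-sided ideal $I$ there are left $B_x$-modules $N_x$ ($x\in\mathscr G^{(0)}$) with $I=\bigcap_{x\in\mathscr G^{(0)}}\mathrm{Ann}(\mathrm{Ind}_x(N_x))$. -/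

import Mathlib

open CategoryTheory Topology
open scoped DirectSum TensorProduct

set_option linter.unusedSectionVars false

universe u w v v'

namespace SheafGroupoid

/-! ### Ample groupoids

A small groupoid is Mathlib's `Groupoid` on the type `X` of objects, which are identified with the
units.  An arrow `γ : x ⟶ y` has domain `d(γ) = x` and range `r(γ) = y`, and the groupoid product
`βγ` (defined when `d(β) = r(γ)`) is `γ ≫ β` in Mathlib's notation. -/

/-- The arrow space. -/
@[ext] structure Arr (X : Type u) [Groupoid.{w} X] where
  dom : X
  rng : X
  hom : dom ⟶ rng

/-- Pairs of arrows `(fst, snd)` with `r(fst) = d(snd)`. -/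
structure Composable (X : Type u) [Groupoid.{w} X] where
  {a b c : X}
  fst : a ⟶ b
  snd : b ⟶ c

section Groupoid

variable {X : Type u} [Groupoid.{w} X]

def Arr.unit (x : X) : Arr X := ⟨x, x, 𝟙 x⟩

def Arr.inv (g : Arr X) : Arr X := ⟨g.rng, g.dom, Groupoid.inv g.hom⟩

def Composable.toProd (c : Composable X) : Arr X × Arr X := (⟨_, _, c.fst⟩, ⟨_, _, c.snd⟩)

/-- The product `snd · fst`. -/
def Composable.comp (c : Composable X) : Arr X := ⟨_, _, c.fst ≫ c.snd⟩

/-- The subspace topology from the product of two copies of the arrow space. -/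
instance [TopologicalSpace (Arr X)] : TopologicalSpace (Composable X) :=
  TopologicalSpace.induced Composable.toProd inferInstance

end Groupoid

/-- An ample groupoid: a topological groupoid (the unit space carries the subspace topology) whose
unit space is locally compact Hausdorff with a basis of compact open sets, and whose range map is
a local homeomorphism. -/
class AmpleGroupoid (X : Type u) [Groupoid.{w} X] [TopologicalSpace X]
    [TopologicalSpace (Arr X)] : Prop where
  isEmbedding_unit : IsEmbedding (Arr.unit : X → Arr X)
  continuous_comp : Continuous (Composable.comp : Composable X → Arr X)
  continuous_inv : Continuous (Arr.inv : Arr X → Arr X)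
  t2Space : T2Space X
  locallyCompactSpace : LocallyCompactSpace X
  isLocalHomeomorph_rng : IsLocalHomeomorph (Arr.rng : Arr X → X)
  isTopologicalBasis : TopologicalSpace.IsTopologicalBasis {U : Set X | IsCompact U ∧ IsOpen U}

/-- Compact open bisections. (They are automatically Hausdorff, since the range map embeds them
in the unit space.) -/
structure IsCompactOpenBisection {X : Type u} [Groupoid.{w} X] [TopologicalSpace (Arr X)]
    (U : Set (Arr X)) : Prop where
  isCompact : IsCompact U
  isOpen : IsOpen U
  injOn_dom : Set.InjOn Arr.dom U
  injOn_rng : Set.InjOn Arr.rng U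

/-- The fibre `r⁻¹(y)` of the range map. -/
abbrev RFib {X : Type u} [Groupoid.{w} X] (y : X) := Σ x : X, (x ⟶ y)

/-- The fibre `L_x = d⁻¹(x)` of the domain map. -/
abbrev DFib {X : Type u} [Groupoid.{w} X] (x : X) := Σ y : X, (x ⟶ y)

/-! ### Sheaves -/

/-- The total space `E = ∐ₓ A x` of a family of stalks; it will carry a topology that is part of the
structure of a sheaf. -/
@[ext] structure Tot {X : Type u} (A : X → Type v) where
  base : X
  val : A base

/-- The fibre product of two total spaces over the base. -/
structure FibProd {X : Type u} (A : X → Type v) (B : X → Type v') where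
  base : X
  fst : A base
  snd : B base

def FibProd.toProd {X : Type u} {A : X → Type v} {B : X → Type v'} (p : FibProd A B) :
    Tot A × Tot B := (⟨_, p.fst⟩, ⟨_, p.snd⟩)

instance {X : Type u} {A : X → Type v} {B : X → Type v'} [TopologicalSpace (Tot A)]
    [TopologicalSpace (Tot B)] : TopologicalSpace (FibProd A B) :=
  TopologicalSpace.induced FibProd.toProd inferInstance

/-- The fibre product of the arrow space (via `d`) with a total space. -/
structure ActProd {X : Type u} [Groupoid.{w} X] (A : X → Type v) where
  {x y : X}
  hom : x ⟶ y
  val : A x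

def ActProd.toProd {X : Type u} [Groupoid.{w} X] {A : X → Type v} (p : ActProd A) :
    Arr X × Tot A := (⟨_, _, p.hom⟩, ⟨_, p.val⟩)

instance {X : Type u} [Groupoid.{w} X] {A : X → Type v} [TopologicalSpace (Arr X)]
    [TopologicalSpace (Tot A)] : TopologicalSpace (ActProd A) :=
  TopologicalSpace.induced ActProd.toProd inferInstance

/-- A sheaf of unital rings over the groupoid: étale space, stalkwise ring structure, and action of
the arrows by ring homomorphisms between the stalks. -/
structure RingSheaf (X : Type u) [Groupoid.{w} X] [TopologicalSpace X]
    [TopologicalSpace (Arr X)] where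
  stalk : X → Type v
  [ring : ∀ x, Ring (stalk x)]
  [top : TopologicalSpace (Tot stalk)]
  isLocalHomeomorph_base : IsLocalHomeomorph (Tot.base : Tot stalk → X)
  continuous_add : Continuous fun p : FibProd stalk stalk => (⟨p.base, p.fst + p.snd⟩ : Tot stalk)
  continuous_mul : Continuous fun p : FibProd stalk stalk => (⟨p.base, p.fst * p.snd⟩ : Tot stalk)
  continuous_one : Continuous fun x : X => (⟨x, 1⟩ : Tot stalk)
  act : ∀ {x y : X}, (x ⟶ y) → (stalk x →+* stalk y)
  act_id : ∀ (x : X) (a : stalk x), act (𝟙 x) a = a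
  act_comp : ∀ {x y z : X} (g : x ⟶ y) (h : y ⟶ z) (a : stalk x), act (g ≫ h) a = act h (act g a)
  continuous_act : Continuous fun p : ActProd stalk => (⟨p.y, act p.hom p.val⟩ : Tot stalk)

attribute [instance] RingSheaf.ring RingSheaf.top

/-- A sheaf of modules over a sheaf of rings on the groupoid. -/
structure ModSheaf {X : Type u} [Groupoid.{w} X] [TopologicalSpace X]
    [TopologicalSpace (Arr X)] (O : RingSheaf.{u, w, v} X) where
  stalk : X → Type v'
  [addCommGroup : ∀ x, AddCommGroup (stalk x)]
  [module : ∀ x, Module (O.stalk x) (stalk x)]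
  [top : TopologicalSpace (Tot stalk)]
  isLocalHomeomorph_base : IsLocalHomeomorph (Tot.base : Tot stalk → X)
  continuous_add : Continuous fun p : FibProd stalk stalk => (⟨p.base, p.fst + p.snd⟩ : Tot stalk)
  continuous_smul :
    Continuous fun p : FibProd O.stalk stalk => (⟨p.base, p.fst • p.snd⟩ : Tot stalk)
  act : ∀ {x y : X}, (x ⟶ y) → (stalk x →+ stalk y)
  act_id : ∀ (x : X) (m : stalk x), act (𝟙 x) m = m
  act_comp : ∀ {x y z : X} (g : x ⟶ y) (h : y ⟶ z) (m : stalk x), act (g ≫ h) m = act h (act g m)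
  act_smul : ∀ {x y : X} (g : x ⟶ y) (r : O.stalk x) (m : stalk x),
    act g (r • m) = O.act g r • act g m
  continuous_act : Continuous fun p : ActProd stalk => (⟨p.y, act p.hom p.val⟩ : Tot stalk)

attribute [instance] ModSheaf.addCommGroup ModSheaf.module ModSheaf.top

/-! ### The convolution algebra -/

section ConvolutionAlgebra

variable {X : Type u} [Groupoid.{w} X] [TopologicalSpace X] [TopologicalSpace (Arr X)]
  (O : RingSheaf.{u, w, v} X)

/-- Maps `f` from arrows to the total space with `p ∘ f = r`. -/
abbrev RingSheaf.Fn := ∀ g : Arr X, O.stalk g.rng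

variable {O}

/-- The value of `f` at the arrow `γ`. -/
abbrev ev (f : O.Fn) {x y : X} (γ : x ⟶ y) : O.stalk y := f ⟨x, y, γ⟩

/-- `f` is supported on the compact open bisection `U` and continuous on `U`. -/
structure IsSupportedOn (f : O.Fn) (U : Set (Arr X)) : Prop where
  bisection : IsCompactOpenBisection U
  continuousOn : ContinuousOn (fun g => (⟨g.rng, f g⟩ : Tot O.stalk)) U
  eq_zero : ∀ g, g ∉ U → f g = 0

/-- The convolution `(f * g)(γ) = ∑_{βρ = γ} f(β) α_β(g(ρ))`; the factorizations of `γ` are indexed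
by `β ∈ r⁻¹(r(γ))`, with `ρ = β⁻¹γ`. -/
noncomputable def conv (f g : O.Fn) : O.Fn := fun γ =>
  ∑ᶠ β : RFib γ.rng, ev f β.2 * O.act β.2 (ev g (γ.hom ≫ Groupoid.inv β.2))

variable (O)

/-- The underlying abelian group of `Γ_c(𝒢, 𝒪)`. -/
def RingSheaf.convSubgroup : AddSubgroup O.Fn :=
  AddSubgroup.closure {f | ∃ U, IsSupportedOn f U}

/-- The convolution algebra `Γ_c(𝒢, 𝒪)`. -/
abbrev RingSheaf.ConvAlg := O.convSubgroup

variable {O}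

theorem IsSupportedOn.finite_rfib {f : O.Fn} {U : Set (Arr X)} (h : IsSupportedOn f U) (y : X) :
    {β : RFib y | ev f β.2 ≠ 0}.Finite := by
  refine Set.Subsingleton.finite ?_
  rintro ⟨a, p⟩ hp ⟨b, q⟩ hq
  have hpU : (⟨a, y, p⟩ : Arr X) ∈ U := by by_contra hn; exact hp (h.eq_zero _ hn)
  have hqU : (⟨b, y, q⟩ : Arr X) ∈ U := by by_contra hn; exact hq (h.eq_zero _ hn)
  have := h.bisection.injOn_rng hpU hqU rfl
  cases this
  rfl

theorem IsSupportedOn.finite_dfib {f : O.Fn} {U : Set (Arr X)} (h : IsSupportedOn f U) (x : X) :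
    {β : DFib x | ev f β.2 ≠ 0}.Finite := by
  refine Set.Subsingleton.finite ?_
  rintro ⟨a, p⟩ hp ⟨b, q⟩ hq
  have hpU : (⟨x, a, p⟩ : Arr X) ∈ U := by by_contra hn; exact hp (h.eq_zero _ hn)
  have hqU : (⟨x, b, q⟩ : Arr X) ∈ U := by by_contra hn; exact hq (h.eq_zero _ hn)
  have := h.bisection.injOn_dom hpU hqU rfl
  cases this
  rfl

theorem finite_rfib {f : O.Fn} (hf : f ∈ O.convSubgroup) (y : X) :
    {β : RFib y | ev f β.2 ≠ 0}.Finite := by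
  induction hf using AddSubgroup.closure_induction with
  | mem f h => obtain ⟨U, hU⟩ := h; exact hU.finite_rfib y
  | zero => simp
  | add f g _ _ hf hg =>
    refine (hf.union hg).subset fun β hβ => ?_
    by_contra hn
    simp only [Set.mem_union, Set.mem_ofPred_eq, not_or, not_not] at hn
    exact hβ (by simp only [ev, Pi.add_apply] at hn ⊢; rw [hn.1, hn.2, add_zero])
  | neg f _ hf => simpa using hf

theorem finite_dfib {f : O.Fn} (hf : f ∈ O.convSubgroup) (x : X) :
    {β : DFib x | ev f β.2 ≠ 0}.Finite := by
  induction hf using AddSubgroup.closure_induction with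
  | mem f h => obtain ⟨U, hU⟩ := h; exact hU.finite_dfib x
  | zero => simp
  | add f g _ _ hf hg =>
    refine (hf.union hg).subset fun β hβ => ?_
    by_contra hn
    simp only [Set.mem_union, Set.mem_ofPred_eq, not_or, not_not] at hn
    exact hβ (by simp only [ev, Pi.add_apply] at hn ⊢; rw [hn.1, hn.2, add_zero])
  | neg f _ hf => simpa using hf

theorem conv_hasFiniteSupport {f : O.Fn} (hf : f ∈ O.convSubgroup) (g : O.Fn) (γ : Arr X) :
    (fun β : RFib γ.rng =>
      ev f β.2 * O.act β.2 (ev g (γ.hom ≫ Groupoid.inv β.2))).HasFiniteSupport :=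
  (finite_rfib hf γ.rng).subset fun β hβ h0 => hβ (by simp only [h0, zero_mul])

theorem conv_add {f : O.Fn} (hf : f ∈ O.convSubgroup) (g h : O.Fn) :
    conv f (g + h) = conv f g + conv f h := by
  funext γ
  simp only [conv, Pi.add_apply, map_add, mul_add]
  exact finsum_add_distrib (conv_hasFiniteSupport hf g γ) (conv_hasFiniteSupport hf h γ)

theorem add_conv {f g : O.Fn} (hf : f ∈ O.convSubgroup) (hg : g ∈ O.convSubgroup) (h : O.Fn) :
    conv (f + g) h = conv f h + conv g h := by
  funext γ
  simp only [conv, Pi.add_apply, add_mul]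
  exact finsum_add_distrib (conv_hasFiniteSupport hf h γ) (conv_hasFiniteSupport hg h γ)

theorem neg_conv (f g : O.Fn) : conv (-f) g = -conv f g := by
  funext γ
  simp only [conv, Pi.neg_apply, neg_mul]
  exact finsum_neg_distrib _

theorem conv_neg (f g : O.Fn) : conv f (-g) = -conv f g := by
  funext γ
  simp only [conv, Pi.neg_apply, map_neg, mul_neg]
  exact finsum_neg_distrib _

theorem zero_conv (f : O.Fn) : conv 0 f = 0 := by
  funext γ
  simp [conv]

theorem conv_zero (f : O.Fn) : conv f 0 = 0 := by
  funext γ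
  simp [conv]

/-- Reindexing `r⁻¹(z)` along left translation by `β⁻¹`. -/
def rfibEquiv {y z : X} (β : y ⟶ z) : RFib z ≃ RFib y where
  toFun ζ := ⟨ζ.1, ζ.2 ≫ Groupoid.inv β⟩
  invFun ρ := ⟨ρ.1, ρ.2 ≫ β⟩
  left_inv ζ := by simp
  right_inv ρ := by simp

theorem finsum_conv_smul {N : X → Type*} [∀ x, AddCommGroup (N x)]
    [∀ x, Module (O.stalk x) (N x)] (b : ∀ {x y : X}, (x ⟶ y) → (N x →+ N y))
    (b_comp : ∀ {x y z : X} (g : x ⟶ y) (h : y ⟶ z) (m : N x), b (g ≫ h) m = b h (b g m))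
    (b_smul : ∀ {x y : X} (g : x ⟶ y) (r : O.stalk x) (m : N x),
      b g (r • m) = O.act g r • b g m)
    {f g : O.Fn} (hf : f ∈ O.convSubgroup) (hg : g ∈ O.convSubgroup) (m : ∀ x, N x) (z : X) :
    ∑ᶠ ζ : RFib z, ev (conv f g) ζ.2 • b ζ.2 (m ζ.1) =
      ∑ᶠ β : RFib z, ev f β.2 • b β.2 (∑ᶠ ρ : RFib β.1, ev g ρ.2 • b ρ.2 (m ρ.1)) := by
  classical
  set S := (finite_rfib hf z).toFinset with hS
  have hS' : ∀ β : RFib z, β ∉ S → ev f β.2 = 0 := fun β hβ => by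
    simpa [hS] using hβ
  have hconv : ∀ ζ : RFib z, ev (conv f g) ζ.2 • b ζ.2 (m ζ.1) =
      ∑ β ∈ S, (ev f β.2 * O.act β.2 (ev g (ζ.2 ≫ Groupoid.inv β.2))) • b ζ.2 (m ζ.1) := by
    intro ζ
    rw [← Finset.sum_smul]
    congr 1
    simp only [ev, conv]
    refine finsum_eq_sum_of_support_subset _ fun β hβ => ?_
    by_contra hn
    exact hβ (by simp only [hS' β hn, zero_mul])
  have hfin : ∀ β : RFib z, (Function.support fun ζ : RFib z =>
      (ev f β.2 * O.act β.2 (ev g (ζ.2 ≫ Groupoid.inv β.2))) • b ζ.2 (m ζ.1)).Finite := by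
    intro β
    refine ((finite_rfib hg β.1).preimage (rfibEquiv β.2).injective.injOn).subset fun ζ hζ => ?_
    intro h0
    apply hζ
    have h0' : ev g (ζ.2 ≫ Groupoid.inv β.2) = 0 := h0
    simp only [h0', map_zero, mul_zero, zero_smul]
  rw [finsum_congr hconv, finsum_sum_comm _ _ fun β _ => hfin β]
  rw [finsum_eq_sum_of_support_subset (s := S)]
  · refine Finset.sum_congr rfl fun β _ => ?_
    have hfg : (Function.support fun ρ : RFib β.1 => ev g ρ.2 • b ρ.2 (m ρ.1)).Finite :=
      (finite_rfib hg β.1).subset fun ρ hρ h0 => hρ (by simp only [h0, zero_smul])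
    rw [AddMonoidHom.map_finsum _ hfg, smul_finsum']
    · rw [← finsum_comp_equiv (rfibEquiv β.2)]
      refine finsum_congr fun ζ => ?_
      have hz : ζ.2 = (ζ.2 ≫ Groupoid.inv β.2) ≫ β.2 := by simp
      change _ = ev f β.2 • b β.2 (ev g (ζ.2 ≫ Groupoid.inv β.2) •
        b (ζ.2 ≫ Groupoid.inv β.2) (m ζ.1))
      rw [b_smul, smul_smul, ← b_comp, ← hz]
    · exact hfg.subset fun ρ hρ h0 => hρ (by simp only [h0, map_zero])
  · intro β hβ
    by_contra hn
    exact hβ (by simp only [hS' β hn, zero_smul])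

/-! #### Closure under convolution -/

theorem continuous_dom [AmpleGroupoid X] : Continuous (Arr.dom : Arr X → X) :=
  (AmpleGroupoid.isLocalHomeomorph_rng.continuous).comp AmpleGroupoid.continuous_inv

theorem isOpenMap_dom [AmpleGroupoid X] : IsOpenMap (Arr.dom : Arr X → X) := by
  have h1 : Function.LeftInverse (Arr.inv : Arr X → Arr X) Arr.inv := fun g => by
    simp [Arr.inv]
  have h2 : IsOpenMap (Arr.inv : Arr X → Arr X) :=
    IsOpenMap.of_inverse AmpleGroupoid.continuous_inv h1 h1
  exact (AmpleGroupoid.isLocalHomeomorph_rng.isOpenMap).comp h2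

theorem isInducing_toProd : IsInducing (Composable.toProd : Composable X → _) := ⟨rfl⟩

theorem range_toProd : Set.range (Composable.toProd : Composable X → _) =
    {p : Arr X × Arr X | p.1.rng = p.2.dom} := by
  ext ⟨⟨a, b, p⟩, ⟨b', c, q⟩⟩
  constructor
  · rintro ⟨⟨p, q⟩, h⟩
    simp only [Composable.toProd, Prod.mk.injEq, Arr.mk.injEq] at h
    obtain ⟨⟨rfl, rfl, h1⟩, ⟨h2, rfl, h3⟩⟩ := h
    exact h2
  · intro h
    change b = b' at h
    subst h
    exact ⟨⟨p, q⟩, rfl⟩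

theorem toProd_injective : Function.Injective (Composable.toProd : Composable X → _) := by
  rintro ⟨p, q⟩ ⟨p', q'⟩ h
  simp only [Composable.toProd, Prod.mk.injEq, Arr.mk.injEq] at h
  obtain ⟨⟨rfl, rfl, h1⟩, ⟨-, rfl, h3⟩⟩ := h
  cases h1
  cases h3
  rfl

theorem isClosedEmbedding_toProd [AmpleGroupoid X] :
    IsClosedEmbedding (Composable.toProd : Composable X → _) := by
  have : T2Space X := AmpleGroupoid.t2Space
  refine ⟨⟨isInducing_toProd, toProd_injective⟩, ?_⟩
  rw [range_toProd]
  exact isClosed_eq (AmpleGroupoid.isLocalHomeomorph_rng.continuous.comp continuous_fst)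
    (continuous_dom.comp continuous_snd)

def Composable.fstArr (c : Composable X) : Arr X := c.toProd.1
def Composable.sndArr (c : Composable X) : Arr X := c.toProd.2

theorem continuous_fstArr : Continuous (Composable.fstArr : Composable X → Arr X) :=
  continuous_fst.comp isInducing_toProd.continuous

theorem continuous_sndArr : Continuous (Composable.sndArr : Composable X → Arr X) :=
  continuous_snd.comp isInducing_toProd.continuous

theorem isOpenMap_fstArr [AmpleGroupoid X] :
    IsOpenMap (Composable.fstArr : Composable X → Arr X) := by
  have hb : TopologicalSpace.IsTopologicalBasis _ :=
    (TopologicalSpace.isTopologicalBasis_opens (α := Arr X)).prod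
      (TopologicalSpace.isTopologicalBasis_opens (α := Arr X))
  rw [(hb.isInducing isInducing_toProd).isOpenMap_iff]
  rintro _ ⟨_, ⟨V, hV, U, hU, rfl⟩, rfl⟩
  have : Composable.fstArr '' (Composable.toProd ⁻¹' V ×ˢ U) =
      V ∩ Arr.rng ⁻¹' (Arr.dom '' U) := by
    ext ⟨a, b, p⟩
    constructor
    · rintro ⟨c, ⟨hc1, hc2⟩, h⟩
      rw [← h]
      exact ⟨hc1, ⟨_, hc2, rfl⟩⟩
    · rintro ⟨h1, ⟨⟨b', c, q⟩, h2, h3⟩⟩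
      change b' = b at h3
      subst h3
      exact ⟨⟨p, q⟩, ⟨h1, h2⟩, rfl⟩
  rw [this]
  exact IsOpen.inter hV ((isOpenMap_dom U hU).preimage
    AmpleGroupoid.isLocalHomeomorph_rng.continuous)

theorem isOpenMap_comp [AmpleGroupoid X] :
    IsOpenMap (Composable.comp : Composable X → Arr X) := by
  let Φ : Composable X → Composable X := fun c => ⟨c.fst ≫ c.snd, Groupoid.inv c.snd⟩
  have hΦ : Function.LeftInverse Φ Φ := fun c => by
    obtain ⟨p, q⟩ := c
    simp [Φ]
  have hc : Continuous Φ := by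
    refine isInducing_toProd.continuous_iff.2 (Continuous.prodMk ?_ ?_)
    · exact AmpleGroupoid.continuous_comp
    · exact AmpleGroupoid.continuous_inv.comp continuous_sndArr
  exact isOpenMap_fstArr.comp (IsOpenMap.of_inverse hc hΦ hΦ)

theorem conv_comp_apply {f g : O.Fn} {U : Set (Arr X)} (hf : IsSupportedOn f U)
    (c : Composable X) (hU : c.sndArr ∈ U) :
    ev (conv f g) (c.fst ≫ c.snd) = ev f c.snd * O.act c.snd (ev g c.fst) := by
  simp only [ev, conv]
  rw [finsum_eq_single _ (⟨c.b, c.snd⟩ : RFib c.c)]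
  · have : (c.fst ≫ c.snd) ≫ Groupoid.inv c.snd = c.fst := by simp
    change ev f c.snd * O.act c.snd (ev g ((c.fst ≫ c.snd) ≫ Groupoid.inv c.snd)) = _
    rw [this]
  · rintro ⟨b, q⟩ hq
    have : (⟨b, c.c, q⟩ : Arr X) ∉ U := by
      intro hn
      apply hq
      have h := hf.bisection.injOn_rng hn hU rfl
      simp only [Composable.sndArr, Composable.toProd, Arr.mk.injEq] at h
      obtain ⟨rfl, -, h⟩ := h
      cases h
      rfl
    rw [hf.eq_zero _ this, zero_mul]

theorem IsSupportedOn.conv [AmpleGroupoid X] {f g : O.Fn} {U V : Set (Arr X)}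
    (hf : IsSupportedOn f U) (hg : IsSupportedOn g V) :
    IsSupportedOn (conv f g)
      (Composable.comp '' (Composable.toProd ⁻¹' V ×ˢ U : Set (Composable X))) where
  bisection :=
    { isCompact := (isClosedEmbedding_toProd.isCompact_preimage
        (hg.bisection.isCompact.prod hf.bisection.isCompact)).image AmpleGroupoid.continuous_comp
      isOpen := isOpenMap_comp _
        ((hg.bisection.isOpen.prod hf.bisection.isOpen).preimage isInducing_toProd.continuous)
      injOn_dom := by
        rintro _ ⟨c, ⟨hc1, hc2⟩, rfl⟩ _ ⟨c', ⟨hc1', hc2'⟩, rfl⟩ h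
        have h1 := hg.bisection.injOn_dom hc1 hc1' h
        have h2 := hf.bisection.injOn_dom hc2 hc2' (congrArg Arr.rng h1)
        rw [toProd_injective (Prod.ext h1 h2)]
      injOn_rng := by
        rintro _ ⟨c, ⟨hc1, hc2⟩, rfl⟩ _ ⟨c', ⟨hc1', hc2'⟩, rfl⟩ h
        have h2 := hf.bisection.injOn_rng hc2 hc2' h
        have h1 := hg.bisection.injOn_rng hc1 hc1' (congrArg Arr.dom h2)
        rw [toProd_injective (Prod.ext h1 h2)] }
  continuousOn := by
    rintro _ ⟨c, ⟨hc1, hc2⟩, rfl⟩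
    refine ContinuousAt.continuousWithinAt ?_
    have hC : (Composable.toProd ⁻¹' V ×ˢ U : Set (Composable X)) ∈ 𝓝 c :=
      ((hg.bisection.isOpen.prod hf.bisection.isOpen).preimage
        isInducing_toProd.continuous).mem_nhds ⟨hc1, hc2⟩
    have hle := isOpenMap_comp.nhds_le c
    refine Filter.Tendsto.mono_left ?_ hle
    rw [Filter.tendsto_map'_iff]
    change ContinuousAt (fun c : Composable X =>
      (⟨c.c, ev (SheafGroupoid.conv f g) (c.fst ≫ c.snd)⟩ : Tot O.stalk)) c
    have heq : (fun c : Composable X => (⟨c.c, ev f c.snd * O.act c.snd (ev g c.fst)⟩ :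
        Tot O.stalk)) =ᶠ[𝓝 c] fun c : Composable X =>
        (⟨c.c, ev (SheafGroupoid.conv f g) (c.fst ≫ c.snd)⟩ : Tot O.stalk) := by
      filter_upwards [hC] with c' hc'
      rw [conv_comp_apply hf c' hc'.2]
    refine ContinuousAt.congr ?_ heq
    have hf' : ContinuousAt (fun c : Composable X => (⟨c.c, ev f c.snd⟩ : Tot O.stalk)) c :=
      ContinuousAt.comp (f := Composable.sndArr) (g := fun g => (⟨g.rng, f g⟩ : Tot O.stalk))
        (hf.continuousOn.continuousAt (hf.bisection.isOpen.mem_nhds hc2))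
        continuous_sndArr.continuousAt
    have hg' : ContinuousAt (fun c : Composable X => (⟨c.b, ev g c.fst⟩ : Tot O.stalk)) c :=
      ContinuousAt.comp (f := Composable.fstArr) (g := fun h => (⟨h.rng, g h⟩ : Tot O.stalk))
        (hg.continuousOn.continuousAt (hg.bisection.isOpen.mem_nhds hc1))
        continuous_fstArr.continuousAt
    have hact : ContinuousAt (fun c : Composable X =>
        (⟨c.c, O.act c.snd (ev g c.fst)⟩ : Tot O.stalk)) c := by
      refine ContinuousAt.comp (g := fun p : ActProd O.stalk =>
        (⟨p.y, O.act p.hom p.val⟩ : Tot O.stalk))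
        (f := fun c : Composable X => (⟨c.snd, ev g c.fst⟩ : ActProd O.stalk))
        O.continuous_act.continuousAt ?_
      refine (IsInducing.continuousAt_iff (g := ActProd.toProd) ⟨rfl⟩).2 ?_
      exact continuous_sndArr.continuousAt.prodMk hg'
    refine ContinuousAt.comp (g := fun p : FibProd O.stalk O.stalk =>
      (⟨p.base, p.fst * p.snd⟩ : Tot O.stalk))
      (f := fun c : Composable X =>
        (⟨c.c, ev f c.snd, O.act c.snd (ev g c.fst)⟩ : FibProd O.stalk O.stalk))
      O.continuous_mul.continuousAt ?_
    refine (IsInducing.continuousAt_iff (g := FibProd.toProd) ⟨rfl⟩).2 ?_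
    exact hf'.prodMk hact
  eq_zero := by
    rintro ⟨x, z, γ⟩ hγ
    simp only [SheafGroupoid.conv]
    refine finsum_eq_zero_of_forall_eq_zero fun β => ?_
    by_contra hn
    apply hγ
    refine ⟨⟨γ ≫ Groupoid.inv β.2, β.2⟩, ⟨?_, ?_⟩, by simp [Composable.comp]⟩
    · by_contra h
      exact hn (by rw [show ev g (γ ≫ Groupoid.inv β.2) = 0 from hg.eq_zero _ h, map_zero,
        mul_zero])
    · by_contra h
      exact hn (by rw [show ev f β.2 = 0 from hf.eq_zero _ h, zero_mul])

theorem conv_mem [AmpleGroupoid X] {f g : O.Fn} (hf : f ∈ O.convSubgroup)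
    (hg : g ∈ O.convSubgroup) : conv f g ∈ O.convSubgroup := by
  induction hf using AddSubgroup.closure_induction with
  | mem f h =>
    obtain ⟨U, hU⟩ := h
    have hfm : f ∈ O.convSubgroup := AddSubgroup.subset_closure ⟨U, hU⟩
    induction hg using AddSubgroup.closure_induction with
    | mem g h =>
      obtain ⟨V, hV⟩ := h
      exact AddSubgroup.subset_closure ⟨_, hU.conv hV⟩
    | zero => rw [conv_zero]; exact zero_mem _
    | add g g' _ _ h h' => rw [conv_add hfm]; exact add_mem h h'
    | neg g _ h => rw [conv_neg]; exact neg_mem h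
  | zero => rw [zero_conv]; exact zero_mem _
  | add f f' h1 h2 h h' => rw [add_conv h1 h2]; exact add_mem h h'
  | neg f _ h => rw [neg_conv]; exact neg_mem h

theorem conv_assoc [AmpleGroupoid X] {f g : O.Fn} (hf : f ∈ O.convSubgroup) (hg : g ∈ O.convSubgroup) (h : O.Fn) :
    conv (conv f g) h = conv f (conv g h) := by
  funext ⟨x, z, γ⟩
  let N : X → Type (max w v) := fun y => (x ⟶ y) → O.stalk y
  let b : ∀ {y z : X}, (y ⟶ z) → (N y →+ N z) := fun {y z} p =>
    { toFun := fun ξ η => O.act p (ξ (η ≫ Groupoid.inv p))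
      map_zero' := funext fun η => map_zero (O.act p)
      map_add' := fun ξ ξ' => funext fun η => map_add (O.act p) _ _ }
  have b_comp : ∀ {y z t : X} (p : y ⟶ z) (q : z ⟶ t) (ξ : N y),
      b (p ≫ q) ξ = b q (b p ξ) := fun {y z t} p q ξ => by
    funext η
    change O.act (p ≫ q) (ξ (η ≫ Groupoid.inv (p ≫ q))) =
      O.act q (O.act p (ξ ((η ≫ Groupoid.inv q) ≫ Groupoid.inv p)))
    rw [O.act_comp]
    simp
  have b_smul : ∀ {y z : X} (p : y ⟶ z) (r : O.stalk y) (ξ : N y),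
      b p (r • ξ) = O.act p r • b p ξ := fun {y z} p r ξ =>
    funext fun η => map_mul (O.act p) _ _
  have key := congrFun (finsum_conv_smul (N := N) b b_comp b_smul hf hg (fun y η => ev h η) z) γ
  have hev : ∀ {y : X} (γ : x ⟶ y) (F : RFib y → N y), (Function.support F).Finite →
      (∑ᶠ i, F i) γ = ∑ᶠ i, F i γ := fun {y} γ F hF =>
    AddMonoidHom.map_finsum (Pi.evalAddMonoidHom (fun _ => O.stalk y) γ) hF
  have hfin : ∀ {k : O.Fn} (_ : k ∈ O.convSubgroup) (y : X) (ξ : ∀ ζ : RFib y, N y),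
      (Function.support fun ζ : RFib y => ev k ζ.2 • ξ ζ).Finite := fun {k} hk y ξ =>
    (finite_rfib hk y).subset fun ρ hρ h0 => hρ (by simp only [h0, zero_smul])
  rw [hev γ _ (hfin hf z _)] at key
  rw [hev γ] at key
  · refine key.trans (finsum_congr fun β => ?_)
    change ev f β.2 * O.act β.2 ((∑ᶠ ρ : RFib β.1, ev g ρ.2 • b ρ.2 fun η => ev h η)
      (γ ≫ Groupoid.inv β.2)) = _
    rw [hev _ _ (hfin hg β.1 _)]
    rfl
  · exact hfin (conv_mem hf hg) z _

noncomputable instance [AmpleGroupoid X] : Mul O.ConvAlg :=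
  ⟨fun f g => ⟨conv f.1 g.1, conv_mem f.2 g.2⟩⟩

noncomputable instance [AmpleGroupoid X] : NonUnitalRing O.ConvAlg where
  left_distrib f g h := Subtype.ext (conv_add f.2 g.1 h.1)
  right_distrib f g h := Subtype.ext (add_conv f.2 g.2 h.1)
  zero_mul f := Subtype.ext (zero_conv f.1)
  mul_zero f := Subtype.ext (conv_zero f.1)
  mul_assoc f g h := Subtype.ext (conv_assoc f.2 g.2 h.1)

end ConvolutionAlgebra

/-! ### Sections of a sheaf of modules -/

section Stalks

variable {X : Type u} [TopologicalSpace X] {A : X → Type v} [∀ x, AddCommGroup (A x)]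
  [TopologicalSpace (Tot A)]

theorem eventuallyEq_of_base_eq (hb : IsLocalHomeomorph (Tot.base : Tot A → X)) {T : Type*}
    [TopologicalSpace T] {t : T} {s s' : T → Tot A} (hs : ContinuousAt s t)
    (hs' : ContinuousAt s' t) (h : ∀ t, (s t).base = (s' t).base) (ht : s t = s' t) :
    s =ᶠ[𝓝 t] s' := by
  obtain ⟨e, he, hbe⟩ := hb (s t)
  have h1 := hs (e.open_source.mem_nhds he)
  have h2 := hs' (e.open_source.mem_nhds (ht ▸ he))
  filter_upwards [h1, h2] with t' h1 h2
  exact e.injOn h1 h2 (by rw [← hbe]; exact h t')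

theorem continuous_zeroSection (hb : IsLocalHomeomorph (Tot.base : Tot A → X))
    (ha : Continuous fun p : FibProd A A => (⟨p.base, p.fst + p.snd⟩ : Tot A)) :
    Continuous fun x : X => (⟨x, 0⟩ : Tot A) := by
  refine continuous_iff_continuousAt.2 fun x => ?_
  have hm := hb.map_nhds_eq (⟨x, 0⟩ : Tot A)
  change Filter.Tendsto _ (𝓝 x) _
  change _ = 𝓝 x at hm
  rw [← hm, Filter.tendsto_map'_iff]
  have hd : Continuous fun e : Tot A => (⟨e.base, e.val + e.val⟩ : Tot A) := by
    refine Continuous.comp (g := fun p : FibProd A A => (⟨p.base, p.fst + p.snd⟩ : Tot A))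
      (f := fun e : Tot A => (⟨e.base, e.val, e.val⟩ : FibProd A A)) ha ?_
    exact (IsInducing.continuous_iff (g := FibProd.toProd) ⟨rfl⟩).2
      (continuous_id.prodMk continuous_id)
  have := eventuallyEq_of_base_eq hb (t := (⟨x, 0⟩ : Tot A)) hd.continuousAt continuousAt_id
    (fun _ => rfl) (by simp)
  refine Filter.Tendsto.congr' (f₁ := id) ?_ Filter.tendsto_id
  filter_upwards [this] with e he
  obtain ⟨y, a⟩ := e
  simp only [id, Tot.mk.injEq, heq_eq_eq, true_and] at he
  simp only [id, Function.comp_apply, Tot.mk.injEq, heq_eq_eq, true_and]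
  simpa using he

theorem continuous_negTot (hb : IsLocalHomeomorph (Tot.base : Tot A → X))
    (ha : Continuous fun p : FibProd A A => (⟨p.base, p.fst + p.snd⟩ : Tot A)) :
    Continuous fun e : Tot A => (⟨e.base, -e.val⟩ : Tot A) := by
  have hind : IsInducing (FibProd.toProd : FibProd A A → _) := ⟨rfl⟩
  have hopen : IsOpenMap fun p : FibProd A A => (⟨p.base, p.fst⟩ : Tot A) := by
    have hbas : TopologicalSpace.IsTopologicalBasis _ :=
      (TopologicalSpace.isTopologicalBasis_opens (α := Tot A)).prod
        (TopologicalSpace.isTopologicalBasis_opens (α := Tot A))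
    rw [(hbas.isInducing hind).isOpenMap_iff]
    rintro _ ⟨_, ⟨V, hV, U, hU, rfl⟩, rfl⟩
    have : (fun p : FibProd A A => (⟨p.base, p.fst⟩ : Tot A)) '' (FibProd.toProd ⁻¹' V ×ˢ U) =
        V ∩ Tot.base ⁻¹' (Tot.base '' U) := by
      ext ⟨x, a⟩
      constructor
      · rintro ⟨p, ⟨h1, h2⟩, h⟩
        rw [← h]
        exact ⟨h1, ⟨_, h2, rfl⟩⟩
      · rintro ⟨h1, ⟨⟨y, b⟩, h2, h3⟩⟩
        change y = x at h3
        subst h3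
        exact ⟨⟨y, a, b⟩, ⟨h1, h2⟩, rfl⟩
    rw [this]
    exact IsOpen.inter hV ((hb.isOpenMap U hU).preimage hb.continuous)
  refine continuous_iff_continuousAt.2 fun ⟨x, a⟩ => ?_
  have hle := hopen.nhds_le (⟨x, a, -a⟩ : FibProd A A)
  refine Filter.Tendsto.mono_left ?_ hle
  rw [Filter.tendsto_map'_iff]
  have hz : Continuous fun p : FibProd A A => (⟨p.base, 0⟩ : Tot A) :=
    (continuous_zeroSection hb ha).comp
      (hb.continuous.comp (continuous_fst.comp hind.continuous))
  have := eventuallyEq_of_base_eq hb (t := (⟨x, a, -a⟩ : FibProd A A)) ha.continuousAt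
    hz.continuousAt (fun _ => rfl) (by simp)
  refine Filter.Tendsto.congr' (f₁ := fun p : FibProd A A => (⟨p.base, p.snd⟩ : Tot A)) ?_
    (continuous_snd.comp hind.continuous).continuousAt
  filter_upwards [this] with p hp
  obtain ⟨y, b, c⟩ := p
  simp only [Tot.mk.injEq, heq_eq_eq, true_and] at hp
  simp only [Function.comp_apply, Tot.mk.injEq, heq_eq_eq, true_and]
  exact (neg_eq_of_add_eq_zero_right hp).symm

theorem isClosed_support (hb : IsLocalHomeomorph (Tot.base : Tot A → X))
    (ha : Continuous fun p : FibProd A A => (⟨p.base, p.fst + p.snd⟩ : Tot A))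
    {s : ∀ x, A x} (hs : Continuous fun x => (⟨x, s x⟩ : Tot A)) : IsClosed {x | s x ≠ 0} := by
  rw [← isOpen_compl_iff, isOpen_iff_mem_nhds]
  intro x hx
  have hx : s x = 0 := by simpa using hx
  have := eventuallyEq_of_base_eq hb hs.continuousAt (continuous_zeroSection hb ha).continuousAt
    (fun _ => rfl) (by simp [hx] : (⟨x, s x⟩ : Tot A) = ⟨x, 0⟩)
  filter_upwards [this] with y hy
  simp only [Tot.mk.injEq, heq_eq_eq, true_and] at hy
  simp [hy]

end Stalks

section Sections

variable {X : Type u} [Groupoid.{w} X] [TopologicalSpace X] [TopologicalSpace (Arr X)]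
  {O : RingSheaf.{u, w, v} X} (M : ModSheaf.{u, w, v, v'} O)

/-- Continuous sections of the sheaf over the unit space with compact support. -/
def ModSheaf.sections : AddSubgroup (∀ x, M.stalk x) where
  carrier := {s | Continuous (fun x => (⟨x, s x⟩ : Tot M.stalk)) ∧ IsCompact {x | s x ≠ 0}}
  zero_mem' := ⟨continuous_zeroSection M.isLocalHomeomorph_base M.continuous_add, by simp⟩
  add_mem' := by
    rintro s t ⟨hs, hs'⟩ ⟨ht, ht'⟩
    have hc : Continuous fun x => (⟨x, (s + t) x⟩ : Tot M.stalk) :=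
      Continuous.comp (g := fun p : FibProd M.stalk M.stalk =>
          (⟨p.base, p.fst + p.snd⟩ : Tot M.stalk))
        (f := fun x => (⟨x, s x, t x⟩ : FibProd M.stalk M.stalk)) M.continuous_add
        ((IsInducing.continuous_iff (g := FibProd.toProd) ⟨rfl⟩).2 (hs.prodMk ht))
    refine ⟨hc, (hs'.union ht').of_isClosed_subset
      (isClosed_support M.isLocalHomeomorph_base M.continuous_add hc) fun x hx => ?_⟩
    by_contra hn
    simp only [Set.mem_union, Set.mem_ofPred_eq, not_or, not_not] at hn
    exact hx (by rw [Pi.add_apply, hn.1, hn.2, add_zero])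
  neg_mem' := by
    rintro s ⟨hs, hs'⟩
    refine ⟨(continuous_negTot M.isLocalHomeomorph_base M.continuous_add).comp hs, ?_⟩
    simpa using hs'

/-- `(f s)(x) = ∑_{γ ∈ r⁻¹(x)} f(γ) β_γ(s(d(γ)))`. -/
noncomputable def secAct (f : O.Fn) (s : ∀ x, M.stalk x) : ∀ x, M.stalk x := fun x =>
  ∑ᶠ γ : RFib x, ev f γ.2 • M.act γ.2 (s γ.1)

variable {M}

theorem secAct_hasFiniteSupport {f : O.Fn} (hf : f ∈ O.convSubgroup) (s : ∀ x, M.stalk x) (x : X) :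
    (fun γ : RFib x => ev f γ.2 • M.act γ.2 (s γ.1)).HasFiniteSupport :=
  (finite_rfib hf x).subset fun β hβ h0 => hβ (by simp only [h0, zero_smul])

theorem secAct_add {f : O.Fn} (hf : f ∈ O.convSubgroup) (s t : ∀ x, M.stalk x) :
    secAct M f (s + t) = secAct M f s + secAct M f t := by
  funext x
  simp only [secAct, Pi.add_apply, map_add, smul_add]
  exact finsum_add_distrib (secAct_hasFiniteSupport hf s x) (secAct_hasFiniteSupport hf t x)

theorem add_secAct {f g : O.Fn} (hf : f ∈ O.convSubgroup) (hg : g ∈ O.convSubgroup)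
    (s : ∀ x, M.stalk x) : secAct M (f + g) s = secAct M f s + secAct M g s := by
  funext x
  simp only [secAct, ev, Pi.add_apply, add_smul]
  exact finsum_add_distrib (secAct_hasFiniteSupport hf s x) (secAct_hasFiniteSupport hg s x)

theorem zero_secAct (s : ∀ x, M.stalk x) : secAct M 0 s = 0 := by
  funext x
  simp [secAct]

theorem secAct_zero (f : O.Fn) : secAct M f 0 = 0 := by
  funext x
  simp [secAct]

theorem neg_secAct (f : O.Fn) (s : ∀ x, M.stalk x) : secAct M (-f) s = -secAct M f s := by
  funext x
  simp only [secAct, ev, Pi.neg_apply, neg_smul]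
  exact finsum_neg_distrib _

theorem secAct_rng_apply {f : O.Fn} {U : Set (Arr X)} (hf : IsSupportedOn f U)
    (s : ∀ x, M.stalk x) {g : Arr X} (hg : g ∈ U) :
    secAct M f s g.rng = ev f g.hom • M.act g.hom (s g.dom) := by
  obtain ⟨x, y, γ⟩ := g
  simp only [secAct]
  rw [finsum_eq_single _ (⟨x, γ⟩ : RFib y)]
  rintro ⟨b, q⟩ hq
  have : (⟨b, y, q⟩ : Arr X) ∉ U := by
    intro hn
    apply hq
    have h := hf.bisection.injOn_rng hn hg rfl
    cases h
    rfl
  rw [show ev f q = 0 from hf.eq_zero _ this, zero_smul]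

theorem IsSupportedOn.secAct_mem [AmpleGroupoid X] {f : O.Fn} {U : Set (Arr X)}
    (hf : IsSupportedOn f U) {s : ∀ x, M.stalk x} (hs : s ∈ M.sections) :
    secAct M f s ∈ M.sections := by
  have : T2Space X := AmpleGroupoid.t2Space
  have hr := AmpleGroupoid.isLocalHomeomorph_rng (X := X)
  have hK : IsCompact (Arr.rng '' U) := hf.bisection.isCompact.image hr.continuous
  have h0 : ∀ x, x ∉ Arr.rng '' U → secAct M f s x = 0 := by
    intro x hx
    simp only [secAct]
    refine finsum_eq_zero_of_forall_eq_zero fun γ => ?_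
    have : (⟨γ.1, x, γ.2⟩ : Arr X) ∉ U := fun hn => hx ⟨_, hn, rfl⟩
    rw [show ev f γ.2 = 0 from hf.eq_zero _ this, zero_smul]
  have hc : Continuous fun x => (⟨x, secAct M f s x⟩ : Tot M.stalk) := by
    refine continuous_iff_continuousAt.2 fun x => ?_
    by_cases hx : x ∈ Arr.rng '' U
    · obtain ⟨g, hg, rfl⟩ := hx
      change Filter.Tendsto _ _ _
      rw [← hr.map_nhds_eq g, Filter.tendsto_map'_iff]
      have hU : U ∈ 𝓝 g := hf.bisection.isOpen.mem_nhds hg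
      have heq : (fun g : Arr X => (⟨g.rng, ev f g.hom • M.act g.hom (s g.dom)⟩ : Tot M.stalk))
          =ᶠ[𝓝 g] fun g : Arr X => (⟨g.rng, secAct M f s g.rng⟩ : Tot M.stalk) := by
        filter_upwards [hU] with g' hg'
        rw [secAct_rng_apply hf s hg']
      refine ContinuousAt.congr ?_ heq
      have hact : Continuous fun g : Arr X => (⟨g.rng, M.act g.hom (s g.dom)⟩ : Tot M.stalk) :=
        Continuous.comp (g := fun p : ActProd M.stalk => (⟨p.y, M.act p.hom p.val⟩ : Tot M.stalk))
          (f := fun g : Arr X => (⟨g.hom, s g.dom⟩ : ActProd M.stalk)) M.continuous_act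
          ((IsInducing.continuous_iff (g := ActProd.toProd) ⟨rfl⟩).2
            (continuous_id.prodMk (hs.1.comp continuous_dom)))
      refine ContinuousAt.comp (g := fun p : FibProd O.stalk M.stalk =>
          (⟨p.base, p.fst • p.snd⟩ : Tot M.stalk))
        (f := fun g : Arr X =>
          (⟨g.rng, ev f g.hom, M.act g.hom (s g.dom)⟩ : FibProd O.stalk M.stalk))
        M.continuous_smul.continuousAt ?_
      refine (IsInducing.continuousAt_iff (g := FibProd.toProd) ⟨rfl⟩).2 ?_
      exact (hf.continuousOn.continuousAt hU).prodMk hact.continuousAt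
    · refine ContinuousAt.congr
        (continuous_zeroSection M.isLocalHomeomorph_base M.continuous_add).continuousAt ?_
      filter_upwards [hK.isClosed.isOpen_compl.mem_nhds hx] with y hy
      rw [h0 y hy]
  refine ⟨hc, hK.of_isClosed_subset
    (isClosed_support M.isLocalHomeomorph_base M.continuous_add hc) fun x hx => ?_⟩
  by_contra hn
  exact hx (h0 x hn)

theorem secAct_mem [AmpleGroupoid X] {f : O.Fn} (hf : f ∈ O.convSubgroup) {s : ∀ x, M.stalk x}
    (hs : s ∈ M.sections) : secAct M f s ∈ M.sections := by
  induction hf using AddSubgroup.closure_induction with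
  | mem f h => obtain ⟨U, hU⟩ := h; exact hU.secAct_mem hs
  | zero => rw [zero_secAct]; exact zero_mem _
  | add f f' h1 h2 h h' => rw [add_secAct h1 h2]; exact add_mem h h'
  | neg f _ h => rw [neg_secAct]; exact neg_mem h

variable (M)

/-- The left `Γ_c(𝒢, 𝒪)`-module `Γ_c(𝒢, ℳ)`, as a representation by additive endomorphisms. -/
noncomputable def ModSheaf.sectionRep [AmpleGroupoid X] :
    O.ConvAlg →ₙ+* AddMonoid.End M.sections where
  toFun f :=
    { toFun := fun s => ⟨secAct M f.1 s.1, secAct_mem f.2 s.2⟩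
      map_zero' := Subtype.ext (secAct_zero f.1)
      map_add' := fun s t => Subtype.ext (secAct_add f.2 s.1 t.1) }
  map_mul' f g := AddMonoidHom.ext fun s => Subtype.ext <| funext fun x =>
    finsum_conv_smul M.act M.act_comp M.act_smul f.2 g.2 s.1 x
  map_zero' := AddMonoidHom.ext fun s => Subtype.ext (zero_secAct s.1)
  map_add' f g := AddMonoidHom.ext fun s => Subtype.ext (add_secAct f.2 g.2 s.1)

end Sections

/-! ### Isotropy skew group rings and induction -/

section Induction

variable {X : Type u} [Groupoid.{w} X] [TopologicalSpace X] [TopologicalSpace (Arr X)]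
  (O : RingSheaf.{u, w, v} X)

/-- The isotropy group `End x` (whose product `β * γ` is `γ ≫ β`) acts on the stalk at `x`. -/
instance (x : X) : MulSemiringAction (End x) (O.stalk x) where
  smul δ a := O.act (End.asHom δ) a
  one_smul a := O.act_id x a
  mul_smul δ η a := O.act_comp (End.asHom η) (End.asHom δ) a
  smul_zero δ := map_zero (O.act (End.asHom δ))
  smul_add δ := map_add (O.act (End.asHom δ))
  smul_one δ := map_one (O.act (End.asHom δ))
  smul_mul δ := map_mul (O.act (End.asHom δ))

/-- The isotropy skew group ring `B_x = 𝒪_x ⋊ 𝒢_x^x`. -/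
abbrev RingSheaf.Isot (x : X) := SkewMonoidAlgebra (O.stalk x) (End x)

/-- The abelian group `𝓛_x = ⨁_{γ ∈ L_x} 𝒪_{r(γ)}`. -/
def RingSheaf.LMod (x : X) : Type (max u w v) := ⨁ γ : DFib x, O.stalk γ.1

noncomputable instance (x : X) : AddCommGroup (O.LMod x) :=
  inferInstanceAs (AddCommGroup (⨁ γ : DFib x, O.stalk γ.1))

variable {O}

namespace LMod

open scoped Classical in
/-- The element `a 1_γ`. -/
noncomputable def single {x y : X} (γ : x ⟶ y) : O.stalk y →+ O.LMod x :=
  DirectSum.of (fun γ : DFib x => O.stalk γ.1) ⟨y, γ⟩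

open scoped Classical in
/-- The additive map out of `𝓛_x` with prescribed values on the elements `a 1_γ`. -/
noncomputable def lift {x : X} {A : Type*} [AddCommMonoid A]
    (φ : ∀ {y : X}, (x ⟶ y) → (O.stalk y →+ A)) : O.LMod x →+ A :=
  DirectSum.toAddMonoid fun γ : DFib x => φ γ.2

/-- The coordinate at `γ`. -/
def coord {x y : X} (γ : x ⟶ y) : O.LMod x →+ O.stalk y where
  toFun ξ := (show Π₀ γ : DFib x, O.stalk γ.1 from ξ) ⟨y, γ⟩
  map_zero' := rfl
  map_add' _ _ := rfl

theorem lift_single {x y : X} {A : Type*} [AddCommMonoid A]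
    (φ : ∀ {y : X}, (x ⟶ y) → (O.stalk y →+ A)) (γ : x ⟶ y) (a : O.stalk y) :
    lift φ (single γ a) = φ γ a := by
  classical
  exact DirectSum.toAddMonoid_of (fun γ : DFib x => φ γ.2) ⟨y, γ⟩ a

theorem hom_ext {x : X} {A : Type*} [AddCommMonoid A] {φ ψ : O.LMod x →+ A}
    (h : ∀ {y : X} (γ : x ⟶ y) (a : O.stalk y), φ (single γ a) = ψ (single γ a)) : φ = ψ := by
  classical
  exact DirectSum.addHom_ext (f := φ) (g := ψ) fun γ a => h γ.2 a

theorem ext_coord {x : X} {ξ η : O.LMod x}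
    (h : ∀ {y : X} (γ : x ⟶ y), coord γ ξ = coord γ η) : ξ = η :=
  DFinsupp.ext (f := (show Π₀ γ : DFib x, O.stalk γ.1 from ξ)) fun γ => h γ.2

theorem coord_single_self {x y : X} (γ : x ⟶ y) (a : O.stalk y) : coord γ (single γ a) = a := by
  classical
  exact DirectSum.of_eq_same (β := fun γ : DFib x => O.stalk γ.1) ⟨y, γ⟩ a

theorem coord_single_of_ne {x y z : X} (γ : x ⟶ y) (η : x ⟶ z) (a : O.stalk y)
    (h : (⟨y, γ⟩ : DFib x) ≠ ⟨z, η⟩) : coord η (single γ a) = 0 := by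
  classical
  exact DirectSum.of_eq_of_ne (β := fun γ : DFib x => O.stalk γ.1) ⟨y, γ⟩ ⟨z, η⟩ a h.symm

/-! #### The right action of the isotropy skew group ring -/

/-- Right multiplication, `a 1_γ · b δ = a α_γ(b) 1_{γδ}`. -/
noncomputable def rightMul (x : X) : O.Isot x →+ (O.LMod x →+ O.LMod x) :=
  (Finsupp.liftAddHom fun δ : End x =>
    { toFun := fun b => lift fun {y} γ =>
        (single (End.asHom δ ≫ γ)).comp (AddMonoidHom.mulRight (O.act γ b))
      map_zero' := hom_ext fun γ a => by simp [lift_single]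
      map_add' := fun b c => hom_ext fun γ a => by
        simp [lift_single, mul_add] }).comp
    (SkewMonoidAlgebra.coeffAddEquiv (k := O.stalk x) (G := End x)).toAddMonoidHom

theorem rightMul_single {x y : X} (δ : End x) (b : O.stalk x) (γ : x ⟶ y) (a : O.stalk y) :
    rightMul x (SkewMonoidAlgebra.single δ b) (single γ a) =
      single (End.asHom δ ≫ γ) (a * O.act γ b) := by
  refine Eq.trans (DFunLike.congr_fun (Finsupp.liftAddHom_apply_single _ δ b) (single γ a)) ?_
  exact lift_single _ γ a

theorem rightMul_mul (x : X) (b c : O.Isot x) :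
    rightMul x (b * c) = (rightMul x c).comp (rightMul x b) := by
  induction b using SkewMonoidAlgebra.induction_on with
  | zero => simp
  | add b b' h h' => simp only [add_mul, map_add, AddMonoidHom.comp_add, h, h']
  | single δ b =>
    induction c using SkewMonoidAlgebra.induction_on with
    | zero => simp
    | add c c' h h' => simp only [map_add, mul_add, AddMonoidHom.add_comp, h, h']
    | single η c =>
      refine hom_ext fun γ a => ?_
      rw [SkewMonoidAlgebra.single_mul_single, AddMonoidHom.comp_apply, rightMul_single,
        rightMul_single, rightMul_single]
      have h1 : End.asHom (δ * η) ≫ γ = End.asHom η ≫ End.asHom δ ≫ γ := Category.assoc _ _ _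
      have h2 : O.act γ (δ • c) = O.act (End.asHom δ ≫ γ) c := (O.act_comp _ _ _).symm
      rw [h1, map_mul (O.act γ), h2, mul_assoc]

theorem rightMul_one (x : X) : rightMul (O := O) x 1 = AddMonoidHom.id _ := by
  refine hom_ext fun γ a => ?_
  rw [SkewMonoidAlgebra.one_def, rightMul_single, map_one, mul_one]
  have : End.asHom (1 : End x) ≫ γ = γ := Category.id_comp _
  rw [this]
  rfl

/-- `𝓛_x` is a right `B_x`-module. -/
noncomputable instance (x : X) : Module (O.Isot x)ᵐᵒᵖ (O.LMod x) where
  smul b ξ := rightMul x b.unop ξ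
  one_smul ξ := by
    change rightMul x 1 ξ = ξ
    rw [rightMul_one]; rfl
  mul_smul b c ξ := by
    change rightMul x (c.unop * b.unop) ξ = _
    rw [rightMul_mul]; rfl
  smul_zero b := map_zero (rightMul x b.unop)
  smul_add b := map_add (rightMul x b.unop)
  zero_smul ξ := by
    change rightMul x 0 ξ = 0
    rw [map_zero]; rfl
  add_smul b c ξ := by
    change rightMul x (b.unop + c.unop) ξ = _
    rw [map_add]; rfl

/-! #### The left action of the convolution algebra -/

theorem leftMul_finite {f : O.Fn} (hf : f ∈ O.convSubgroup) {x y : X} (γ : x ⟶ y)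
    (a : O.stalk y) : (Function.support fun β : DFib y =>
      (single (γ ≫ β.2) (ev f β.2 * O.act β.2 a) : O.LMod x)).Finite :=
  (finite_dfib hf y).subset fun β hβ h0 => hβ (by
    have h0 : ev f β.2 = 0 := h0
    simp only [h0, zero_mul, map_zero])

/-- Left multiplication, `f · a 1_γ = ∑_{d(β) = r(γ)} f(β) α_β(a) 1_{βγ}`. -/
noncomputable def leftMul (x : X) (f : O.ConvAlg) : O.LMod x →+ O.LMod x :=
  lift fun {y} γ =>
    { toFun := fun a => ∑ᶠ β : DFib y, single (γ ≫ β.2) (ev f.1 β.2 * O.act β.2 a)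
      map_zero' := by simp
      map_add' := fun a b => by
        simp only [map_add, mul_add]
        exact finsum_add_distrib (leftMul_finite f.2 γ a) (leftMul_finite f.2 γ b) }

theorem leftMul_single {x y : X} (f : O.ConvAlg) (γ : x ⟶ y) (a : O.stalk y) :
    leftMul x f (single γ a) =
      ∑ᶠ β : DFib y, single (γ ≫ β.2) (ev f.1 β.2 * O.act β.2 a) :=
  lift_single _ γ a

theorem coord_leftMul_single {x y z : X} (f : O.ConvAlg) (γ : x ⟶ y) (a : O.stalk y) (η : x ⟶ z) :
    coord η (leftMul x f (single γ a)) =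
      ev f.1 (Groupoid.inv γ ≫ η) * O.act (Groupoid.inv γ ≫ η) a := by
  rw [leftMul_single, AddMonoidHom.map_finsum _ (leftMul_finite f.2 γ a),
    finsum_eq_single _ (⟨z, Groupoid.inv γ ≫ η⟩ : DFib y)]
  · have h : γ ≫ Groupoid.inv γ ≫ η = η := by simp
    change coord η (single (γ ≫ Groupoid.inv γ ≫ η) _) = _
    rw [h, coord_single_self]
  · rintro ⟨t, β⟩ hβ
    apply coord_single_of_ne
    intro h
    apply hβ
    cases h
    simp

/-- Reindexing `d⁻¹(y)` as `r⁻¹(z)` along `β ↦ ζ β⁻¹`. -/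
def dfibEquiv {y z : X} (ζ : y ⟶ z) : DFib y ≃ RFib z where
  toFun β := ⟨β.1, Groupoid.inv β.2 ≫ ζ⟩
  invFun δ := ⟨δ.1, ζ ≫ Groupoid.inv δ.2⟩
  left_inv β := by simp
  right_inv δ := by simp

theorem leftMul_mul [AmpleGroupoid X] (x : X) (f g : O.ConvAlg) :
    leftMul x (f * g) = (leftMul x f).comp (leftMul x g) := by
  refine hom_ext fun {y} γ a => ext_coord fun {z} η => ?_
  rw [coord_leftMul_single, AddMonoidHom.comp_apply, leftMul_single g,
    AddMonoidHom.map_finsum _ (leftMul_finite g.2 γ a), AddMonoidHom.map_finsum]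
  · set ζ := Groupoid.inv γ ≫ η with hζ
    change (∑ᶠ δ : RFib z, ev f.1 δ.2 * O.act δ.2 (ev g.1 (ζ ≫ Groupoid.inv δ.2))) * O.act ζ a = _
    rw [finsum_mul' _ _ (conv_hasFiniteSupport f.2 g.1 ⟨y, z, ζ⟩),
      ← finsum_comp_equiv (dfibEquiv ζ)]
    refine finsum_congr fun β => ?_
    rw [coord_leftMul_single]
    have h1 : Groupoid.inv (γ ≫ β.2) ≫ η = Groupoid.inv β.2 ≫ ζ := by simp [hζ]
    have h2 : ζ ≫ Groupoid.inv (Groupoid.inv β.2 ≫ ζ) = β.2 := by simp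
    have h3 : O.act (Groupoid.inv β.2 ≫ ζ) (O.act β.2 a) = O.act ζ a := by
      rw [← O.act_comp]
      simp
    change ev f.1 (Groupoid.inv β.2 ≫ ζ) * O.act (Groupoid.inv β.2 ≫ ζ)
      (ev g.1 (ζ ≫ Groupoid.inv (Groupoid.inv β.2 ≫ ζ))) * O.act ζ a = _
    rw [h1, h2, map_mul, h3, mul_assoc]
  · exact (leftMul_finite g.2 γ a).subset fun β hβ h0 => hβ (by simp only [h0, map_zero])

theorem leftMul_zero (x : X) : leftMul (O := O) x 0 = 0 := by
  refine hom_ext fun {y} γ a => ext_coord fun {z} η => ?_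
  rw [coord_leftMul_single, AddMonoidHom.zero_apply, map_zero]
  exact zero_mul _

theorem leftMul_add (x : X) (f g : O.ConvAlg) :
    leftMul x (f + g) = leftMul x f + leftMul x g := by
  refine hom_ext fun {y} γ a => ext_coord fun {z} η => ?_
  rw [coord_leftMul_single, AddMonoidHom.add_apply, map_add, coord_leftMul_single,
    coord_leftMul_single]
  exact add_mul _ _ _

/-- `𝓛_x` as a left `Γ_c(𝒢, 𝒪)`-module. -/
noncomputable def leftRep [AmpleGroupoid X] (x : X) : O.ConvAlg →ₙ+* AddMonoid.End (O.LMod x) where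
  toFun := leftMul x
  map_mul' := leftMul_mul x
  map_zero' := leftMul_zero x
  map_add' := leftMul_add x

/-- The two actions on `𝓛_x` commute. -/
theorem leftRep_smul [AmpleGroupoid X] (x : X) (f : O.ConvAlg) (b : (O.Isot x)ᵐᵒᵖ)
    (ξ : O.LMod x) : leftRep x f (b • ξ) = b • leftRep x f ξ := by
  suffices h : ∀ b : O.Isot x,
      (leftMul x f).comp (rightMul x b) = (rightMul x b).comp (leftMul x f) from
    DFunLike.congr_fun (h b.unop) ξ
  intro b
  induction b using SkewMonoidAlgebra.induction_on with
  | zero => simp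
  | add b b' h h' => simp only [map_add, AddMonoidHom.add_comp, AddMonoidHom.comp_add, h, h']
  | single δ b =>
    refine hom_ext fun {y} γ a => ?_
    rw [AddMonoidHom.comp_apply, AddMonoidHom.comp_apply, rightMul_single, leftMul_single,
      leftMul_single, AddMonoidHom.map_finsum _ (leftMul_finite f.2 γ a)]
    refine finsum_congr fun β => ?_
    rw [rightMul_single, map_mul (O.act β.2), mul_assoc, Category.assoc, O.act_comp]

end LMod

/-! #### Tensor products over a noncommutative ring -/

/-- The abelian group `N ⊗_R P`, for a right module `N` and a left module `P` over `R`. -/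
def BalancedTensor (R : Type*) [Ring R] (N : Type*) [AddCommGroup N] [Module Rᵐᵒᵖ N]
    (P : Type*) [AddCommGroup P] [Module R P] :=
  (N ⊗[ℤ] P) ⧸ AddSubgroup.closure
    {t : N ⊗[ℤ] P | ∃ (n : N) (r : R) (p : P), t = (MulOpposite.op r • n) ⊗ₜ p - n ⊗ₜ (r • p)}

namespace BalancedTensor

variable {R : Type*} [Ring R] {N : Type*} [AddCommGroup N] [Module Rᵐᵒᵖ N]
  {P : Type*} [AddCommGroup P] [Module R P]

noncomputable instance : AddCommGroup (BalancedTensor R N P) :=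
  inferInstanceAs (AddCommGroup (_ ⧸ AddSubgroup.closure _))

/-- The class of a tensor. -/
def mk : N ⊗[ℤ] P →+ BalancedTensor R N P := QuotientAddGroup.mk' _

theorem hom_ext {A : Type*} [AddCommGroup A] {φ ψ : BalancedTensor R N P →+ A}
    (h : ∀ (n : N) (p : P), φ (mk (n ⊗ₜ p)) = ψ (mk (n ⊗ₜ p))) : φ = ψ := by
  refine AddMonoidHom.ext fun t => ?_
  obtain ⟨t, rfl⟩ := QuotientAddGroup.mk'_surjective _ t
  change φ (mk t) = ψ (mk t)
  induction t using TensorProduct.induction_on with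
  | zero => simp
  | tmul n p => exact h n p
  | add s t hs ht => simp only [map_add, hs, ht]

/-- The endomorphism `φ ⊗ id` of `N ⊗_R P`, for `φ` a right `R`-linear endomorphism of `N`. -/
noncomputable def map (φ : N →+ N) (h : ∀ (r : Rᵐᵒᵖ) (n : N), φ (r • n) = r • φ n) :
    BalancedTensor R N P →+ BalancedTensor R N P :=
  QuotientAddGroup.map _ _ (LinearMap.rTensor P φ.toIntLinearMap).toAddMonoidHom
    ((AddSubgroup.closure_le _).2 (by
      rintro _ ⟨n, r, p, rfl⟩
      refine AddSubgroup.subset_closure ⟨φ n, r, p, ?_⟩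
      rw [map_sub, ← h]
      rfl))

theorem map_mk_tmul (φ : N →+ N) (h : ∀ (r : Rᵐᵒᵖ) (n : N), φ (r • n) = r • φ n) (n : N) (p : P) :
    map φ h (mk (R := R) (n ⊗ₜ p)) = mk (φ n ⊗ₜ p) := rfl

end BalancedTensor

/-- The induced module `Ind_x(P) = 𝓛_x ⊗_{B_x} P`. -/
abbrev RingSheaf.Ind (O : RingSheaf.{u, w, v} X) (x : X) (P : Type v') [AddCommGroup P]
    [Module (O.Isot x) P] := BalancedTensor (O.Isot x) (O.LMod x) P

/-- The left `Γ_c(𝒢, 𝒪)`-module structure of `Ind_x(P)`, `f · (ξ ⊗ p) = (f · ξ) ⊗ p`, as a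
representation by additive endomorphisms. -/
noncomputable def RingSheaf.indRep [AmpleGroupoid X] (O : RingSheaf.{u, w, v} X) (x : X)
    (P : Type v') [AddCommGroup P] [Module (O.Isot x) P] :
    O.ConvAlg →ₙ+* AddMonoid.End (O.Ind x P) where
  toFun f := BalancedTensor.map (LMod.leftRep x f) (LMod.leftRep_smul x f)
  map_mul' f g := BalancedTensor.hom_ext fun n p => by
    change BalancedTensor.mk (R := O.Isot x) (LMod.leftMul x (f * g) n ⊗ₜ p) =
      BalancedTensor.mk (R := O.Isot x) (LMod.leftMul x f (LMod.leftMul x g n) ⊗ₜ p)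
    rw [LMod.leftMul_mul]
    rfl
  map_zero' := BalancedTensor.hom_ext fun n p => by
    change BalancedTensor.mk (R := O.Isot x) (LMod.leftMul x 0 n ⊗ₜ p) = 0
    rw [LMod.leftMul_zero, AddMonoidHom.zero_apply, TensorProduct.zero_tmul, map_zero]
  map_add' f g := BalancedTensor.hom_ext fun n p => by
    change BalancedTensor.mk (R := O.Isot x) (LMod.leftMul x (f + g) n ⊗ₜ p) =
      BalancedTensor.mk (R := O.Isot x) (LMod.leftMul x f n ⊗ₜ p) + BalancedTensor.mk (R := O.Isot x) (LMod.leftMul x g n ⊗ₜ p)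
    rw [LMod.leftMul_add, AddMonoidHom.add_apply, TensorProduct.add_tmul, map_add]

/-! #### The stalks of a sheaf of modules as modules over the isotropy skew group rings -/

variable (M : ModSheaf.{u, w, v, v'} O)

/-- The action `(b δ) · m = b β_δ(m)`. -/
noncomputable def ModSheaf.stalkRep (x : X) : O.Isot x →+* AddMonoid.End (M.stalk x) :=
  SkewMonoidAlgebra.liftNCRingHom (Module.toAddMonoidEnd (O.stalk x) (M.stalk x))
    { toFun := fun δ : End x => M.act (End.asHom δ)
      map_one' := AddMonoidHom.ext fun m => M.act_id x m
      map_mul' := fun δ η => AddMonoidHom.ext fun m =>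
        M.act_comp (End.asHom η) (End.asHom δ) m }
    (fun {b δ} => AddMonoidHom.ext fun m => (M.act_smul (End.asHom δ) b m).symm)

theorem ModSheaf.stalkRep_single (x : X) (δ : End x) (b : O.stalk x) (m : M.stalk x) :
    M.stalkRep x (SkewMonoidAlgebra.single δ b) m = b • M.act (End.asHom δ) m := by
  exact DFunLike.congr_fun (SkewMonoidAlgebra.liftNC_single
    (Module.toAddMonoidEnd (O.stalk x) (M.stalk x) : O.stalk x →+ AddMonoid.End (M.stalk x))
    (fun δ : End x => (M.act (End.asHom δ) : AddMonoid.End (M.stalk x))) δ b) m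

noncomputable instance (x : X) : Module (O.Isot x) (M.stalk x) :=
  Module.compHom (M.stalk x) (M.stalkRep x)

end Induction

/-- The annihilator of a left module (possibly over a ring without unit), given by the corresponding
representation by additive endomorphisms: the two-sided ideal of all `r` acting as `0`. -/
abbrev Ann {R : Type*} [NonUnitalRing R] {P : Type*} [AddCommGroup P]
    (ρ : R →ₙ+* AddMonoid.End P) : TwoSidedIdeal R := TwoSidedIdeal.ker ρ

end SheafGroupoid

namespace SheafGroupoid

/-! Both parts come from one criterion, `StalkAction.mem_iInf_ann_indRep`, which needs no topology
on the modules. Let `N` be a family of modules over the stalks of `O` with a functorial semilinear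
action of the arrows. An element f of the convolution algebra acts on arbitrary families `s` by the
usual formula (`sumAct`). The map a1_γ ⊗ n ↦ aγ(n) embeds Ind_x(N_x) equivariantly in the direct sum
of all N_z (`indMap_injective`, `indMap_indRep`). It is injective because fixing one arrow from x to
each point of its orbit gives every tensor over that point the form 1_ζ ⊗ n. Hence f kills all
induced modules exactly when it kills every family concentrated at one point.

Only finitely many arrows into z carry a nonzero value of f, so (fs)(z) sees `s` at finitely many
points only. Suppose a set `P` of families interpolates: any value at y is attained by a member of
`P` that vanishes at finitely many prescribed other points. Then killing `P` and killing all
one-point families are the same condition. Compactly supported continuous sections interpolate,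
because the base is Hausdorff with a basis of compact open sets; this is the first part.

For an ideal I, let N_x be the quotient of the convolution algebra by the elements a with 1_V a ∈ I
for some compact open V containing x. An arrow acts on these germs through multiplication by any
function on a bisection containing it (`germ_mul_eq_zero`, `germ_mul_congr`). The germ families of
algebra elements interpolate (`exists_germ_eq`), f acts on them by left multiplication (`germ_mul`),
and local units with compactness show that f lies in I exactly when it kills all of them
(`mem_iff_germ_mul`). No sheaf topology on the N_x has to be constructed. -/

theorem finsum_comp_of_injective {α β A : Type*} [AddCommMonoid A] {f : α → A} {g : β → α}
    (hg : Function.Injective g) (h : ∀ a, a ∉ Set.range g → f a = 0) :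
    ∑ᶠ a, f a = ∑ᶠ b, f (g b) := by
  rw [← finsum_mem_range hg, ← finsum_mem_univ]
  refine finsum_mem_inter_support_eq' _ _ _ fun a ha => ?_
  simp only [Set.mem_univ, true_iff]
  by_contra hn
  exact ha (h a hn)

/-- The additive map out of `N ⊗_R P` induced by a balanced biadditive map. -/
noncomputable def BalancedTensor.lift {R : Type*} [Ring R] {N : Type*} [AddCommGroup N]
    [Module Rᵐᵒᵖ N] {P : Type*} [AddCommGroup P] [Module R P] {A : Type*} [AddCommGroup A]
    (φ : N →+ P →+ A) (h : ∀ (r : R) (n : N) (p : P), φ (MulOpposite.op r • n) p = φ n (r • p)) :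
    BalancedTensor R N P →+ A :=
  QuotientAddGroup.lift _
    (TensorProduct.liftAddHom φ fun r n p => by simp)
    ((AddSubgroup.closure_le _).2 (by
      rintro _ ⟨n, r, p, rfl⟩
      change _ = _
      rw [map_sub, TensorProduct.liftAddHom_tmul, TensorProduct.liftAddHom_tmul, h, sub_self]))

theorem BalancedTensor.mk_smul_tmul {R : Type*} [Ring R] {N : Type*} [AddCommGroup N]
    [Module Rᵐᵒᵖ N] {P : Type*} [AddCommGroup P] [Module R P] (r : R) (n : N) (p : P) :
    mk (R := R) ((MulOpposite.op r • n) ⊗ₜ p) = mk (R := R) (n ⊗ₜ (r • p)) := by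
  rw [← sub_eq_zero, ← map_sub]
  exact (QuotientAddGroup.eq_zero_iff _).2 (AddSubgroup.subset_closure ⟨n, r, p, rfl⟩)

/-! ### Arrow actions on families of modules, and the annihilator criterion -/

section StalkAction

variable {X : Type u} [Groupoid.{w} X] [TopologicalSpace X] [TopologicalSpace (Arr X)]

/-- A functorial action of the arrows on a family of modules over the stalks of `O`: a sheaf of
modules without its topology. -/
structure StalkAction (O : RingSheaf.{u, w, v} X) (N : X → Type v') [∀ x, AddCommGroup (N x)]
    [∀ x, Module (O.stalk x) (N x)] where
  act : ∀ {x y : X}, (x ⟶ y) → (N x →+ N y)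
  act_id : ∀ (x : X) (n : N x), act (𝟙 x) n = n
  act_comp : ∀ {x y z : X} (g : x ⟶ y) (h : y ⟶ z) (n : N x), act (g ≫ h) n = act h (act g n)
  act_smul : ∀ {x y : X} (g : x ⟶ y) (r : O.stalk x) (n : N x),
    act g (r • n) = O.act g r • act g n

namespace StalkAction

variable {O : RingSheaf.{u, w, v} X} {N : X → Type v'} [∀ x, AddCommGroup (N x)]
  [∀ x, Module (O.stalk x) (N x)] (b : StalkAction O N)

/-- The action `(c δ) · n = c β_δ(n)` of the isotropy skew group ring. -/
noncomputable def isotRep (x : X) : O.Isot x →+* AddMonoid.End (N x) :=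
  SkewMonoidAlgebra.liftNCRingHom (Module.toAddMonoidEnd (O.stalk x) (N x))
    { toFun := fun δ : End x => b.act (End.asHom δ)
      map_one' := AddMonoidHom.ext fun n => b.act_id x n
      map_mul' := fun δ η => AddMonoidHom.ext fun n =>
        b.act_comp (End.asHom η) (End.asHom δ) n }
    (fun {c δ} => AddMonoidHom.ext fun n => (b.act_smul (End.asHom δ) c n).symm)

theorem isotRep_single (x : X) (δ : End x) (c : O.stalk x) (n : N x) :
    b.isotRep x (SkewMonoidAlgebra.single δ c) n = c • b.act (End.asHom δ) n :=
  DFunLike.congr_fun (SkewMonoidAlgebra.liftNC_single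
    (Module.toAddMonoidEnd (O.stalk x) (N x) : O.stalk x →+ AddMonoid.End (N x))
    (fun δ : End x => (b.act (End.asHom δ) : AddMonoid.End (N x))) δ c) n

theorem sumAct_finite {f : O.Fn} (hf : f ∈ O.convSubgroup) (s : ∀ x, N x) (z : X) :
    (Function.support fun β : RFib z => ev f β.2 • b.act β.2 (s β.1)).Finite :=
  (finite_rfib hf z).subset fun β hβ h0 => hβ (by simp only [h0, zero_smul])

/-- `(f s)(z) = ∑_{β ∈ r⁻¹(z)} f(β) β(s(d(β)))`. -/
noncomputable def sumAct (f : O.ConvAlg) : (∀ x, N x) →+ (∀ x, N x) where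
  toFun s z := ∑ᶠ β : RFib z, ev f.1 β.2 • b.act β.2 (s β.1)
  map_zero' := by
    funext z
    simp
  map_add' s t := by
    funext z
    simp only [Pi.add_apply, map_add, smul_add]
    exact finsum_add_distrib (b.sumAct_finite f.2 s z) (b.sumAct_finite f.2 t z)

theorem sumAct_apply (f : O.ConvAlg) (s : ∀ x, N x) (z : X) :
    b.sumAct f s z = ∑ᶠ β : RFib z, ev f.1 β.2 • b.act β.2 (s β.1) := rfl

open scoped Classical in
/-- The domains of the arrows with range `z` on which `f` does not vanish. -/
noncomputable def domFinset (f : O.ConvAlg) (z : X) : Finset X :=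
  (finite_rfib f.2 z).toFinset.image Sigma.fst

/-- Finiteness of f on the fibre over z makes the value there depend on finitely many points. This
is what lets families without any continuity be compared with sections. -/
theorem sumAct_congr (f : O.ConvAlg) {s t : ∀ x, N x} {z : X}
    (h : ∀ x ∈ domFinset f z, s x = t x) : b.sumAct f s z = b.sumAct f t z := by
  classical
  refine finsum_congr fun β => ?_
  by_cases hβ : ev f.1 β.2 = 0
  · rw [hβ, zero_smul, zero_smul]
  · rw [h β.1 (Finset.mem_image_of_mem _ (by simpa using hβ))]

open scoped Classical in
-- An arbitrary family is not a finite sum of one-point families, but for a fixed z it can be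
-- replaced by one.
theorem sumAct_eq_zero_of_single (f : O.ConvAlg)
    (h : ∀ (y : X) (n : N y), b.sumAct f (Pi.single y n) = 0) (s : ∀ x, N x) :
    b.sumAct f s = 0 := by
  funext z
  rw [b.sumAct_congr f (t := ∑ y ∈ domFinset f z, Pi.single y (s y)), map_sum]
  · simp [h]
  · intro x hx
    rw [Finset.sum_apply, Finset.sum_pi_single, if_pos hx]

open scoped Classical in
theorem sumAct_single (f : O.ConvAlg) (y : X) (n : N y) (z : X) :
    b.sumAct f (Pi.single y n) z = ∑ᶠ β : y ⟶ z, ev f.1 β • b.act β n := by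
  rw [sumAct_apply, finsum_comp_of_injective (g := fun β : y ⟶ z => (⟨y, β⟩ : RFib z))]
  · simp
  · exact sigma_mk_injective (β := fun x : X => (x ⟶ z))
  · rintro ⟨x, β⟩ hβ
    rw [Pi.single_eq_of_ne, map_zero, smul_zero]
    rintro rfl
    exact hβ ⟨β, rfl⟩

/-! ### Embedding an induced module in the direct sum of the stalks -/

variable [∀ x, Module (O.Isot x) (N x)]
  (hb : ∀ (x : X) (δ : End x) (c : O.stalk x) (n : N x),
    SkewMonoidAlgebra.single δ c • n = c • b.act (End.asHom δ) n)

open scoped Classical in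
/-- The biadditive map `(a 1_γ, n) ↦ a γ(n)`, with the value placed at `r(γ)`. -/
noncomputable def pairing (x : X) : O.LMod x →+ N x →+ Π₀ z, N z :=
  LMod.lift fun {y} γ =>
    { toFun := fun a => (DFinsupp.singleAddHom N y).comp
        ((DistribSMul.toAddMonoidHom (N y) a).comp (b.act γ))
      map_zero' := AddMonoidHom.ext fun n => by simp
      map_add' := fun a a' => AddMonoidHom.ext fun n => by simp [add_smul] }

open scoped Classical in
theorem pairing_single {x y : X} (γ : x ⟶ y) (a : O.stalk y) (n : N x) :
    b.pairing x (LMod.single γ a) n = DFinsupp.single y (a • b.act γ n) := by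
  rw [pairing, LMod.lift_single]
  rfl

theorem op_single_smul_single {x y : X} (δ : End x) (c : O.stalk x) (γ : x ⟶ y) (a : O.stalk y) :
    MulOpposite.op (SkewMonoidAlgebra.single δ c) • (LMod.single γ a : O.LMod x) =
      LMod.single (End.asHom δ ≫ γ) (a * O.act γ c) :=
  LMod.rightMul_single δ c γ a

include hb in
-- By additivity it suffices to treat r = cδ and ξ = a1_γ. Both sides then place aα_γ(c)·(γδ)(n) at
-- r(γ), by functoriality and semilinearity.
theorem pairing_balanced (x : X) (r : O.Isot x) (ξ : O.LMod x) (n : N x) :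
    b.pairing x (MulOpposite.op r • ξ) n = b.pairing x ξ (r • n) := by
  induction r using SkewMonoidAlgebra.induction_on generalizing n with
  | zero => simp
  | add r r' h h' => simp only [MulOpposite.op_add, add_smul, map_add, AddMonoidHom.add_apply, h, h']
  | single δ c =>
    suffices h : ((AddMonoidHom.eval n).comp (b.pairing x)).comp
        (DistribSMul.toAddMonoidHom (O.LMod x) (MulOpposite.op (SkewMonoidAlgebra.single δ c))) =
        (AddMonoidHom.eval (SkewMonoidAlgebra.single δ c • n)).comp (b.pairing x) from
      DFunLike.congr_fun h ξ
    refine LMod.hom_ext fun {y} γ a => ?_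
    change b.pairing x (MulOpposite.op (SkewMonoidAlgebra.single δ c) • LMod.single γ a) n =
      b.pairing x (LMod.single γ a) (SkewMonoidAlgebra.single δ c • n)
    rw [op_single_smul_single, pairing_single, pairing_single, hb, b.act_smul, b.act_comp,
      smul_smul]

/-- `Ind_x(N_x) → ⨁_z N_z`, `a 1_γ ⊗ n ↦ a γ(n)`. -/
noncomputable def indMap (x : X) : O.Ind x (N x) →+ Π₀ z, N z :=
  BalancedTensor.lift (b.pairing x) (b.pairing_balanced hb x)

open scoped Classical in
theorem indMap_single {x y : X} (γ : x ⟶ y) (a : O.stalk y) (n : N x) :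
    b.indMap hb x (BalancedTensor.mk (LMod.single γ a ⊗ₜ n)) =
      DFinsupp.single y (a • b.act γ n) :=
  b.pairing_single γ a n

include hb in
-- Normal form relative to a reference arrow ζ: a1_γ is 1_ζ multiplied on the right by
-- α_{ζ⁻¹}(a)·ζ⁻¹γ, and this element of the skew group ring can be moved across the tensor sign.
theorem mk_single_tmul {x y : X} (γ ζ : x ⟶ y) (a : O.stalk y) (n : N x) :
    (BalancedTensor.mk (LMod.single γ a ⊗ₜ n) : O.Ind x (N x)) =
      BalancedTensor.mk (LMod.single ζ 1 ⊗ₜ b.act (Groupoid.inv ζ) (a • b.act γ n)) := by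
  have h := BalancedTensor.mk_smul_tmul (R := O.Isot x)
    (SkewMonoidAlgebra.single (End.of (γ ≫ Groupoid.inv ζ)) (O.act (Groupoid.inv ζ) a))
    (LMod.single ζ 1 : O.LMod x) n
  rw [op_single_smul_single, hb, ← O.act_comp, Groupoid.inv_comp, O.act_id, one_mul] at h
  have h1 : End.asHom (End.of (γ ≫ Groupoid.inv ζ)) = γ ≫ Groupoid.inv ζ := rfl
  have h2 : (γ ≫ Groupoid.inv ζ) ≫ ζ = γ := by simp
  rw [h1, h2, b.act_comp, ← b.act_smul] at h
  exact h

theorem ind_hom_ext {x : X} {A : Type*} [AddCommGroup A] {φ ψ : O.Ind x (N x) →+ A}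
    (h : ∀ {y : X} (γ : x ⟶ y) (a : O.stalk y) (n : N x),
      φ (BalancedTensor.mk (LMod.single γ a ⊗ₜ n)) = ψ (BalancedTensor.mk (LMod.single γ a ⊗ₜ n))) :
    φ = ψ := by
  refine BalancedTensor.hom_ext fun ξ n => ?_
  suffices h' : ∀ χ : O.Ind x (N x) →+ A, ∃ χ' : O.LMod x →+ A,
      ∀ ξ, χ' ξ = χ (BalancedTensor.mk (ξ ⊗ₜ n)) by
    obtain ⟨φ', hφ⟩ := h' φ
    obtain ⟨ψ', hψ⟩ := h' ψ
    rw [← hφ, ← hψ]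
    refine DFunLike.congr_fun (LMod.hom_ext fun γ a => ?_) ξ
    rw [hφ, hψ, h]
  intro χ
  exact ⟨(χ.comp BalancedTensor.mk).comp
    ((TensorProduct.mk ℤ (O.LMod x) (N x)).flip n).toAddMonoidHom, fun _ => rfl⟩

open scoped Classical in
/-- A left inverse of `indMap`. -/
noncomputable def indSection (x : X) : (Π₀ z, N z) →+ O.Ind x (N x) :=
  DFinsupp.liftAddHom fun z =>
    -- `h.some` is the reference arrow to z. A value at z is carried back to x along its inverse;
    -- coordinates off the orbit of x are discarded.
    if h : Nonempty (x ⟶ z) then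
      (BalancedTensor.mk (R := O.Isot x)).comp (((TensorProduct.mk ℤ (O.LMod x) (N x)
        (LMod.single h.some 1)).toAddMonoidHom).comp (b.act (Groupoid.inv h.some)))
    else 0

/-- On generators, mapping to the direct sum and back gives the normal form of `mk_single_tmul`
relative to the chosen arrow. -/
theorem indMap_injective (x : X) : Function.Injective (b.indMap hb x) := by
  classical
  suffices h : (b.indSection x).comp (b.indMap hb x) = AddMonoidHom.id _ from
    Function.LeftInverse.injective (g := b.indSection x) (DFunLike.congr_fun h)
  refine ind_hom_ext fun {y} γ a n => ?_
  have hy : Nonempty (x ⟶ y) := ⟨γ⟩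
  rw [AddMonoidHom.comp_apply, indMap_single, indSection, DFinsupp.liftAddHom_apply_single,
    dif_pos hy]
  exact (b.mk_single_tmul hb γ hy.some a n).symm

variable [AmpleGroupoid X]

/-- Equivariance of the embedding. On a generator over y both sides are sums over arrows out of y,
and the coordinate at z keeps those that end at z. -/
theorem indMap_indRep (x : X) (f : O.ConvAlg) (t : O.Ind x (N x)) :
    ⇑(b.indMap hb x (O.indRep x (N x) f t)) = b.sumAct f (b.indMap hb x t) := by
  classical
  suffices h : (DFinsupp.coeFnAddMonoidHom.comp (b.indMap hb x)).comp (O.indRep x (N x) f) =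
      (b.sumAct f).comp (DFinsupp.coeFnAddMonoidHom.comp (b.indMap hb x)) from
    DFunLike.congr_fun h t
  refine ind_hom_ext fun {y} γ a n => ?_
  funext z
  change b.pairing x (LMod.leftMul x f (LMod.single γ a)) n z =
    b.sumAct f (b.indMap hb x (BalancedTensor.mk (LMod.single γ a ⊗ₜ n))) z
  rw [indMap_single, DFinsupp.single_eq_pi_single, sumAct_single, LMod.leftMul_single]
  let χ : O.LMod x →+ N z :=
    (DFinsupp.evalAddMonoidHom z).comp ((AddMonoidHom.eval n).comp (b.pairing x))
  change χ (∑ᶠ β : DFib y, LMod.single (γ ≫ β.2) (ev f.1 β.2 * O.act β.2 a)) = _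
  rw [AddMonoidHom.map_finsum _ (LMod.leftMul_finite f.2 γ a)]
  have hχ : ∀ β : DFib y, χ (LMod.single (γ ≫ β.2) (ev f.1 β.2 * O.act β.2 a)) =
      DFinsupp.single β.1 (ev f.1 β.2 • b.act β.2 (a • b.act γ n)) z := fun β => by
    change b.pairing x (LMod.single (γ ≫ β.2) (ev f.1 β.2 * O.act β.2 a)) n z = _
    rw [pairing_single, b.act_smul, b.act_comp, smul_smul]
  rw [finsum_congr hχ, finsum_comp_of_injective (g := fun β : y ⟶ z => (⟨z, β⟩ : DFib y))]
  · simp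
  · exact sigma_mk_injective
  · rintro ⟨z', β⟩ hβ
    refine DFinsupp.single_eq_of_ne ?_
    rintro rfl
    exact hβ ⟨β, rfl⟩

include hb in
/-- If the sections in `P` interpolate, the elements of `Γ_c(𝒢, 𝒪)` that annihilate `P` are
those that annihilate all modules induced from the stalks. -/
theorem mem_iInf_ann_indRep (P : Set (∀ x, N x))
    (hP : ∀ (y : X) (n : N y) (F : Finset X), y ∉ F → ∃ s ∈ P, s y = n ∧ ∀ x ∈ F, s x = 0)
    (f : O.ConvAlg) :
    f ∈ ⨅ x, Ann (O.indRep x (N x)) ↔ ∀ s ∈ P, b.sumAct f s = 0 := by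
  classical
  rw [TwoSidedIdeal.mem_iInf]
  constructor
  · intro h s _
    refine b.sumAct_eq_zero_of_single f (fun y n => ?_) s
    -- The tensor 1_y ⊗ n, with the unit arrow at y, maps to the family with value n concentrated at
    -- y.
    have h1 := b.indMap_indRep hb y f (BalancedTensor.mk (LMod.single (𝟙 y) 1 ⊗ₜ n))
    rw [(TwoSidedIdeal.mem_ker _).1 (h y), indMap_single, one_smul, b.act_id,
      DFinsupp.single_eq_pi_single] at h1
    rw [← h1]
    simp
  · intro h x
    rw [TwoSidedIdeal.mem_ker]
    refine AddMonoidHom.ext fun t => b.indMap_injective hb x ?_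
    refine DFunLike.coe_injective ?_
    refine (b.indMap_indRep hb x f t).trans (Eq.trans ?_ (congrArg _ (map_zero _)).symm)
    refine b.sumAct_eq_zero_of_single f (fun y n => ?_) _
    funext z
    -- This s agrees with the one-point family wherever f looks in computing the value at z. Its
    -- choice depends on z, which is harmless since vanishing is checked pointwise.
    obtain ⟨s, hs, hsy, hsF⟩ := hP y n ((domFinset f z).erase y) (Finset.notMem_erase _ _)
    rw [← congrFun (h s hs) z]
    refine b.sumAct_congr f fun x hx => ?_
    by_cases hxy : x = y
    · subst hxy
      rw [Pi.single_eq_same, hsy]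
    · rw [Pi.single_eq_of_ne hxy, hsF x (Finset.mem_erase.2 ⟨hxy, hx⟩)]

end StalkAction

end StalkAction

/-! ### Compact open sets, local sections and bisections -/

section Topology

variable {X : Type u} [Groupoid.{w} X] [TopologicalSpace X] [TopologicalSpace (Arr X)]
  [AmpleGroupoid X]

open TopologicalSpace (CompactOpens)

variable (X) in
theorem exists_compactOpens {x : X} {W : Set X} (hW : IsOpen W) (hx : x ∈ W) :
    ∃ V : CompactOpens X, x ∈ V ∧ (V : Set X) ⊆ W := by
  obtain ⟨V, ⟨hc, ho⟩, hxV, hVW⟩ :=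
    AmpleGroupoid.isTopologicalBasis.exists_subset_of_mem_open hx hW
  exact ⟨⟨⟨V, hc⟩, ho⟩, hxV, hVW⟩

variable (X) in
theorem isClosed_compactOpens (V : CompactOpens X) : IsClosed (V : Set X) :=
  have : T2Space X := AmpleGroupoid.t2Space
  V.isCompact.isClosed

variable (X) in
-- A local inverse of the base map through c is cut down to a compact open set and extended by zero.
-- The extension is continuous because compact sets are closed in the Hausdorff base.
theorem exists_section {A : X → Type*} [∀ x, AddCommGroup (A x)] [TopologicalSpace (Tot A)]
    (hb : IsLocalHomeomorph (Tot.base : Tot A → X))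
    (ha : Continuous fun p : FibProd A A => (⟨p.base, p.fst + p.snd⟩ : Tot A))
    {x : X} (c : A x) {W : Set X} (hW : IsOpen W) (hx : x ∈ W) :
    ∃ (s : ∀ x, A x) (V : CompactOpens X), Continuous (fun x => (⟨x, s x⟩ : Tot A)) ∧ s x = c ∧
      (V : Set X) ⊆ W ∧ ∀ y ∉ V, s y = 0 := by
  classical
  obtain ⟨e, he, hbe⟩ := hb ⟨x, c⟩
  have hex : e ⟨x, c⟩ = x := by rw [← hbe]
  obtain ⟨V, hxV, hV⟩ := exists_compactOpens X (e.open_target.inter hW)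
    ⟨by rw [← hex]; exact e.map_source he, hx⟩
  have hs : ∀ y ∈ V, ∃ a : A y, (⟨y, a⟩ : Tot A) = e.symm y := fun y hy => by
    have h := e.right_inv (hV hy).1
    rw [← hbe] at h
    -- The point is generalized to a variable so that its base can be identified with y by
    -- substitution.
    obtain ⟨t, ht⟩ : ∃ t, t = e.symm y := ⟨_, rfl⟩
    rw [← ht] at h ⊢
    obtain ⟨z, a⟩ := t
    change z = y at h
    subst h
    exact ⟨a, rfl⟩
  choose! s hs using hs
  refine ⟨fun y => if y ∈ V then s y else 0, V, ?_, ?_, fun y hy => (hV hy).2,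
    fun y hy => if_neg hy⟩
  · refine continuous_iff_continuousAt.2 fun y => ?_
    by_cases hy : y ∈ V
    · refine (e.continuousAt_symm (hV hy).1).congr ?_
      filter_upwards [V.isOpen.mem_nhds hy] with z hz
      rw [if_pos (show z ∈ V from hz), hs z hz]
    · refine (continuous_zeroSection hb ha).continuousAt.congr ?_
      filter_upwards [(isClosed_compactOpens X V).isOpen_compl.mem_nhds hy] with z hz
      rw [if_neg (show z ∉ V from hz)]
  · have h := hs x hxV
    have h' : e.symm x = ⟨x, c⟩ := by
      rw [← e.left_inv he, hex]
    rw [h'] at h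
    simp only [Tot.mk.injEq, heq_eq_eq, true_and] at h
    simp only [if_pos hxV, h]

theorem isLocalHomeomorph_dom : IsLocalHomeomorph (Arr.dom : Arr X → X) := by
  let e : Arr X ≃ₜ Arr X :=
    { toFun := Arr.inv
      invFun := Arr.inv
      left_inv := fun g => by simp [Arr.inv]
      right_inv := fun g => by simp [Arr.inv]
      continuous_toFun := AmpleGroupoid.continuous_inv
      continuous_invFun := AmpleGroupoid.continuous_inv }
  exact AmpleGroupoid.isLocalHomeomorph_rng.comp e.isLocalHomeomorph

/-- The unit map is a continuous section of the local homeomorphism r, hence itself a local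
homeomorphism. -/
theorem isOpenMap_unit : IsOpenMap (Arr.unit : X → Arr X) :=
  (IsLocalHomeomorph.of_comp (g := (Arr.rng : Arr X → X)) (f := Arr.unit)
    (Homeomorph.refl X).isLocalHomeomorph AmpleGroupoid.isLocalHomeomorph_rng
    AmpleGroupoid.isEmbedding_unit.continuous).isOpenMap

theorem isCompactOpenBisection_unit (V : CompactOpens X) :
    IsCompactOpenBisection (Arr.unit '' (V : Set X)) where
  isCompact := V.isCompact.image AmpleGroupoid.isEmbedding_unit.continuous
  isOpen := isOpenMap_unit _ V.isOpen
  injOn_dom := by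
    rintro _ ⟨x, -, rfl⟩ _ ⟨y, -, rfl⟩ h
    exact congrArg _ h
  injOn_rng := by
    rintro _ ⟨x, -, rfl⟩ _ ⟨y, -, rfl⟩ h
    exact congrArg _ h

/-- Near g both r and d are injective; the bisection is the image, under the local inverse of r, of
a small compact open set of units. -/
theorem exists_bisection (g : Arr X) : ∃ U : Set (Arr X), IsCompactOpenBisection U ∧ g ∈ U := by
  obtain ⟨e, he, hre⟩ := AmpleGroupoid.isLocalHomeomorph_rng g
  obtain ⟨e', he', hde⟩ := isLocalHomeomorph_dom g
  obtain ⟨V, hgV, hV⟩ := exists_compactOpens X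
    (e.isOpen_image_of_subset_source (e.open_source.inter e'.open_source) Set.inter_subset_left)
    (Set.mem_image_of_mem e ⟨he, he'⟩)
  have hVt : (V : Set X) ⊆ e.target := fun v hv => by
    obtain ⟨w, hw, rfl⟩ := hV hv
    exact e.map_source hw.1
  have hsub : e.symm '' V ⊆ e.source ∩ e'.source := by
    rintro _ ⟨v, hv, rfl⟩
    obtain ⟨w, hw, rfl⟩ := hV hv
    rw [e.left_inv hw.1]
    exact hw
  refine ⟨e.symm '' V, ⟨V.isCompact.image_of_continuousOn (e.continuousOn_symm.mono hVt),
    e.symm.isOpen_image_of_subset_source V.isOpen hVt, ?_, ?_⟩, ⟨e g, hgV, e.left_inv he⟩⟩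
  · rw [hde]
    exact e'.injOn.mono fun _ h => (hsub h).2
  · rw [hre]
    exact e.injOn.mono fun _ h => (hsub h).1

theorem IsCompactOpenBisection.exists_rng_image {U : Set (Arr X)} (hU : IsCompactOpenBisection U) :
    ∃ V : CompactOpens X, (V : Set X) = Arr.rng '' U :=
  ⟨⟨⟨_, hU.isCompact.image AmpleGroupoid.isLocalHomeomorph_rng.continuous⟩,
    AmpleGroupoid.isLocalHomeomorph_rng.isOpenMap _ hU.isOpen⟩, rfl⟩

theorem IsCompactOpenBisection.exists_dom_image {U : Set (Arr X)} (hU : IsCompactOpenBisection U) :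
    ∃ V : CompactOpens X, (V : Set X) = Arr.dom '' U :=
  ⟨⟨⟨_, hU.isCompact.image continuous_dom⟩, isOpenMap_dom _ hU.isOpen⟩, rfl⟩

/-! ### Functions on bisections, the idempotents 1_V and local units -/

variable {O : RingSheaf.{u, w, v} X}

open scoped Classical in
/-- The function on the bisection `U` with values given by the section `s` at the range. -/
noncomputable def bump (U : Set (Arr X)) (s : ∀ x, O.stalk x) : O.Fn :=
  fun g => if g ∈ U then s g.rng else 0

theorem bump_of_mem {U : Set (Arr X)} (s : ∀ x, O.stalk x) {g : Arr X} (hg : g ∈ U) :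
    bump U s g = s g.rng := if_pos hg

theorem isSupportedOn_bump {U : Set (Arr X)} (hU : IsCompactOpenBisection U) {s : ∀ x, O.stalk x}
    (hs : Continuous fun x => (⟨x, s x⟩ : Tot O.stalk)) : IsSupportedOn (bump U s) U where
  bisection := hU
  continuousOn := (hs.comp AmpleGroupoid.isLocalHomeomorph_rng.continuous).continuousOn.congr
    fun g hg => by rw [bump_of_mem s hg]; rfl
  eq_zero _ hg := if_neg hg

theorem IsSupportedOn.mem {f : O.Fn} {U : Set (Arr X)} (h : IsSupportedOn f U) :
    f ∈ O.convSubgroup :=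
  AddSubgroup.subset_closure ⟨U, h⟩

/-- The idempotent `1_V` of the convolution algebra. -/
noncomputable def idem (V : CompactOpens X) : O.ConvAlg :=
  ⟨bump (Arr.unit '' (V : Set X)) 1,
    (isSupportedOn_bump (isCompactOpenBisection_unit V) O.continuous_one).mem⟩

theorem isSupportedOn_idem (V : CompactOpens X) :
    IsSupportedOn (idem V : O.ConvAlg).1 (Arr.unit '' (V : Set X)) :=
  isSupportedOn_bump (isCompactOpenBisection_unit V) O.continuous_one

open scoped Classical in
theorem idem_apply_unit (V : CompactOpens X) (x : X) :
    ev (idem V : O.ConvAlg).1 (𝟙 x) = if x ∈ V then 1 else 0 := by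
  have h : (Arr.unit x ∈ Arr.unit '' (V : Set X)) ↔ x ∈ V :=
    AmpleGroupoid.isEmbedding_unit.injective.mem_set_image
  by_cases hx : x ∈ V
  · rw [if_pos hx]
    exact if_pos (h.2 hx)
  · rw [if_neg hx]
    exact if_neg fun h' => hx (h.1 h')

theorem idem_apply_of_ne_unit (V : CompactOpens X) {g : Arr X} (hg : ∀ x, g ≠ Arr.unit x) :
    (idem V : O.ConvAlg).1 g = 0 :=
  (isSupportedOn_idem V).eq_zero g fun ⟨x, _, hx⟩ => hg x hx.symm

open scoped Classical in
-- Only the factorization of g with the unit at r(g) on the left contributes. Thus multiplying by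
-- 1_V on the left localizes at the range, which is how germs are defined below.
theorem idem_mul_apply (V : CompactOpens X) (a : O.ConvAlg) (g : Arr X) :
    (idem V * a).1 g = if g.rng ∈ V then a.1 g else 0 := by
  obtain ⟨x, y, γ⟩ := g
  change ∑ᶠ β : RFib y, ev (idem V : O.ConvAlg).1 β.2 * O.act β.2 (ev a.1 (γ ≫ Groupoid.inv β.2)) = _
  rw [finsum_eq_single _ (⟨y, 𝟙 y⟩ : RFib y)]
  · have h : γ ≫ Groupoid.inv (𝟙 y) = γ := by simp
    rw [idem_apply_unit, O.act_id, h]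
    by_cases hy : y ∈ V <;> simp [hy]
  · rintro ⟨z, β⟩ hβ
    have : (idem V : O.ConvAlg).1 ⟨z, y, β⟩ = 0 := idem_apply_of_ne_unit V fun t ht => by
      cases ht
      exact hβ rfl
    change (idem V : O.ConvAlg).1 ⟨z, y, β⟩ * _ = 0
    rw [this, zero_mul]

open scoped Classical in
theorem mul_idem_apply (V : CompactOpens X) (a : O.ConvAlg) (g : Arr X) :
    (a * idem V).1 g = if g.dom ∈ V then a.1 g else 0 := by
  obtain ⟨x, y, γ⟩ := g
  change ∑ᶠ β : RFib y, ev a.1 β.2 * O.act β.2 (ev (idem V : O.ConvAlg).1 (γ ≫ Groupoid.inv β.2)) = _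
  rw [finsum_eq_single _ (⟨x, γ⟩ : RFib y)]
  · have h : γ ≫ Groupoid.inv γ = 𝟙 x := by simp
    rw [h, idem_apply_unit]
    by_cases hx : x ∈ V <;> simp [hx]
  · rintro ⟨z, β⟩ hβ
    have : (idem V : O.ConvAlg).1 ⟨x, z, γ ≫ Groupoid.inv β⟩ = 0 :=
      idem_apply_of_ne_unit V fun t ht => by
        obtain ⟨rfl, h⟩ : x = t ∧ z = t := ⟨congrArg Arr.dom ht, congrArg Arr.rng ht⟩
        subst h
        apply hβ
        simp only [Arr.unit, Arr.mk.injEq, heq_eq_eq, true_and] at ht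
        have : γ = β := by
          have := congrArg (· ≫ β) ht
          simpa using this
        rw [this]
    change _ * O.act β ((idem V : O.ConvAlg).1 ⟨x, z, γ ≫ Groupoid.inv β⟩) = 0
    rw [this, map_zero, mul_zero]

theorem idem_mul_idem_of_le {V W : CompactOpens X} (h : W ≤ V) :
    (idem W * idem V : O.ConvAlg) = idem W := by
  refine Subtype.ext (funext fun g => ?_)
  rw [idem_mul_apply]
  by_cases hg : ∃ x, g = Arr.unit x
  · obtain ⟨x, rfl⟩ := hg
    have h1 := idem_apply_unit (O := O) V x
    have h2 := idem_apply_unit (O := O) W x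
    by_cases hx : x ∈ W
    · rw [if_pos hx] at h2
      rw [if_pos (h hx)] at h1
      exact (if_pos hx).trans (h1.trans h2.symm)
    · rw [if_neg hx] at h2
      exact (if_neg hx).trans h2.symm
  · rw [idem_apply_of_ne_unit V (by simpa using hg), idem_apply_of_ne_unit W (by simpa using hg),
      ite_self]

/-- Inclusion–exclusion; it passes ideal membership of 1_V a and 1_W a to the union. -/
theorem idem_sup_mul (V W : CompactOpens X) (a : O.ConvAlg) :
    idem (V ⊔ W) * a = idem V * a + idem W * a - idem V * (idem W * a) := by
  classical
  refine Subtype.ext (funext fun g => ?_)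
  change (idem (V ⊔ W) * a).1 g =
    (idem V * a).1 g + (idem W * a).1 g - (idem V * (idem W * a)).1 g
  have h : g.rng ∈ V ⊔ W ↔ g.rng ∈ V ∨ g.rng ∈ W := Iff.rfl
  simp only [idem_mul_apply, h]
  by_cases h1 : g.rng ∈ V <;> by_cases h2 : g.rng ∈ W <;> simp [h1, h2]

theorem exists_compactOpens_support (a : O.ConvAlg) :
    ∃ V : CompactOpens X, ∀ g, a.1 g ≠ 0 → g.rng ∈ V ∧ g.dom ∈ V := by
  obtain ⟨a, ha⟩ := a
  induction ha using AddSubgroup.closure_induction with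
  | mem f h =>
    obtain ⟨U, hU⟩ := h
    obtain ⟨V, hV⟩ := hU.bisection.exists_rng_image
    obtain ⟨W, hW⟩ := hU.bisection.exists_dom_image
    refine ⟨V ⊔ W, fun g hg => ?_⟩
    have hgU : g ∈ U := by
      by_contra hn
      exact hg (hU.eq_zero g hn)
    have h1 : g.rng ∈ (V : Set X) := hV ▸ Set.mem_image_of_mem _ hgU
    have h2 : g.dom ∈ (W : Set X) := hW ▸ Set.mem_image_of_mem _ hgU
    exact ⟨Or.inl h1, Or.inr h2⟩
  | zero => exact ⟨⊥, fun g hg => absurd rfl hg⟩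
  | add f f' _ _ h h' =>
    obtain ⟨V, hV⟩ := h
    obtain ⟨W, hW⟩ := h'
    refine ⟨V ⊔ W, fun g hg => ?_⟩
    by_cases h1 : f g = 0
    · have h2 : f' g ≠ 0 := fun h2 => hg (by
        change f g + f' g = 0
        rw [h1, h2, add_zero])
      exact ⟨Or.inr (hW g h2).1, Or.inr (hW g h2).2⟩
    · exact ⟨Or.inl (hV g h1).1, Or.inl (hV g h1).2⟩
  | neg f _ h =>
    obtain ⟨V, hV⟩ := h
    exact ⟨V, fun g hg => hV g fun h0 => hg (by
      change -f g = 0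
      rw [show f g = 0 from h0, neg_zero])⟩

/-- Local units. The left identity is needed for all larger sets because the compactness argument in
`mem_iff_germ_mul` ends with a set of which only the inclusion is known. -/
theorem exists_compactOpens_idem_mul (a : O.ConvAlg) :
    ∃ V : CompactOpens X, (∀ W : CompactOpens X, V ≤ W → idem W * a = a) ∧
      a * idem V = a := by
  obtain ⟨V, hV⟩ := exists_compactOpens_support a
  refine ⟨V, fun W hW => Subtype.ext (funext fun g => ?_), Subtype.ext (funext fun g => ?_)⟩
  · rw [idem_mul_apply]
    by_cases hg : a.1 g = 0
    · rw [hg, ite_self]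
    · rw [if_pos (hW (hV g hg).1)]
  · rw [mul_idem_apply]
    by_cases hg : a.1 g = 0
    · rw [hg, ite_self]
    · rw [if_pos (hV g hg).2]

/-! ### The annihilator of the module of sections -/

variable (M : ModSheaf.{u, w, v, v'} O)

/-- The action of the arrows on the stalks of a sheaf of modules. -/
def ModSheaf.stalkAction : StalkAction O M.stalk where
  act := M.act
  act_id := M.act_id
  act_comp := M.act_comp
  act_smul := M.act_smul

/-- The interpolation property of sections: finite sets are closed in the Hausdorff base, so a
section through n can be supported away from F. -/
theorem ModSheaf.exists_mem_sections (y : X) (n : M.stalk y) (F : Finset X) (hy : y ∉ F) :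
    ∃ s ∈ (M.sections : Set (∀ x, M.stalk x)), s y = n ∧ ∀ x ∈ F, s x = 0 := by
  have : T2Space X := AmpleGroupoid.t2Space
  obtain ⟨s, V, hs, hsy, hV, hs0⟩ := exists_section X M.isLocalHomeomorph_base M.continuous_add n
    (F.finite_toSet.isClosed.isOpen_compl) (by simpa using hy)
  refine ⟨s, ⟨hs, V.isCompact.of_isClosed_subset
    (isClosed_support M.isLocalHomeomorph_base M.continuous_add hs) fun x hx => ?_⟩, hsy,
    fun x hx => hs0 x fun hxV => hV hxV hx⟩
  by_contra hn
  exact hx (hs0 x hn)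

theorem ModSheaf.ann_sectionRep :
    Ann M.sectionRep = ⨅ x : X, Ann (O.indRep x (M.stalk x)) := by
  refine SetLike.ext fun f => ?_
  rw [M.stalkAction.mem_iInf_ann_indRep (fun x δ c n => M.stalkRep_single x δ c n) M.sections
    M.exists_mem_sections, TwoSidedIdeal.mem_ker]
  constructor
  · intro h s hs
    exact congrArg Subtype.val (DFunLike.congr_fun h ⟨s, hs⟩)
  · intro h
    exact AddMonoidHom.ext fun s => Subtype.ext (h s.1 s.2)

end Topology

/-! ### Germs of the convolution algebra modulo a two-sided ideal -/

section IdealGerms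

variable {X : Type u} [Groupoid.{w} X] [TopologicalSpace X] [TopologicalSpace (Arr X)]
  [AmpleGroupoid X] {O : RingSheaf.{u, w, v} X} (I : TwoSidedIdeal O.ConvAlg)

open TopologicalSpace (CompactOpens)

/-- The elements of the convolution algebra that lie in `I` near the range `x`. -/
def germKer (x : X) : AddSubgroup O.ConvAlg where
  carrier := {a | ∃ V : CompactOpens X, x ∈ V ∧ idem V * a ∈ I}
  zero_mem' := by
    obtain ⟨V, hV, -⟩ := exists_compactOpens X isOpen_univ (Set.mem_univ x)
    exact ⟨V, hV, by rw [mul_zero]; exact I.zero_mem⟩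
  add_mem' := by
    rintro a a' ⟨V, hV, ha⟩ ⟨V', hV', ha'⟩
    obtain ⟨W, hW, hWV⟩ := exists_compactOpens X (V.isOpen.inter V'.isOpen) ⟨hV, hV'⟩
    refine ⟨W, hW, ?_⟩
    rw [mul_add]
    refine I.add_mem ?_ ?_
    · rw [← idem_mul_idem_of_le (fun _ h => (hWV h).1 : W ≤ V), mul_assoc]
      exact I.mul_mem_left _ _ ha
    · rw [← idem_mul_idem_of_le (fun _ h => (hWV h).2 : W ≤ V'), mul_assoc]
      exact I.mul_mem_left _ _ ha'
  neg_mem' := by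
    rintro a ⟨V, hV, ha⟩
    exact ⟨V, hV, by rw [mul_neg]; exact I.neg_mem ha⟩

/-- The stalk at `x` of the quotient of the convolution algebra by `I`. -/
def QuotStalk (x : X) : Type (max u w v) := O.ConvAlg ⧸ germKer I x

instance (x : X) : AddCommGroup (QuotStalk I x) :=
  inferInstanceAs (AddCommGroup (O.ConvAlg ⧸ germKer I x))

/-- The germ at `x` of an element of the convolution algebra, modulo `I`. -/
def germ (x : X) : O.ConvAlg →+ QuotStalk I x := QuotientAddGroup.mk' _

variable {I}

theorem germ_surjective (x : X) : Function.Surjective (germ I x) :=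
  QuotientAddGroup.mk'_surjective _

theorem germ_eq_zero {x : X} {a : O.ConvAlg} :
    germ I x a = 0 ↔ ∃ V : CompactOpens X, x ∈ V ∧ idem V * a ∈ I :=
  QuotientAddGroup.eq_zero_iff a

theorem germ_eq_of_idem_mul_eq {x : X} {a a' : O.ConvAlg} {V : CompactOpens X} (hx : x ∈ V)
    (h : idem V * a = idem V * a') : germ I x a = germ I x a' := by
  rw [← sub_eq_zero, ← map_sub, germ_eq_zero]
  exact ⟨V, hx, by rw [mul_sub, h, sub_self]; exact I.zero_mem⟩

theorem germ_idem_mul {x : X} {V : CompactOpens X} (hx : x ∈ V) (a : O.ConvAlg) :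
    germ I x (idem V * a) = germ I x a :=
  germ_eq_of_idem_mul_eq hx (by rw [← mul_assoc, idem_mul_idem_of_le le_rfl])

theorem germ_eq_zero_of_vanishing {x : X} {a : O.ConvAlg} {V : CompactOpens X} (hx : x ∈ V)
    (h : ∀ g : Arr X, g.rng ∈ V → a.1 g = 0) : germ I x a = 0 := by
  rw [← map_zero (germ I x)]
  refine germ_eq_of_idem_mul_eq hx ?_
  rw [mul_zero]
  refine Subtype.ext (funext fun g => ?_)
  rw [idem_mul_apply]
  by_cases hg : g.rng ∈ V
  · rw [if_pos hg, h g hg]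
    rfl
  · rw [if_neg hg]
    rfl

/-- Membership in I is a local condition. Conversely to the evident direction, taking for a a right
local unit of f makes all germs of f itself vanish; compactness and inclusion–exclusion then give
one V containing W with 1_V f ∈ I, and 1_V f = f. -/
theorem mem_iff_germ_mul (f : O.ConvAlg) :
    f ∈ I ↔ ∀ (a : O.ConvAlg) (x : X), germ I x (f * a) = 0 := by
  constructor
  · intro h a x
    obtain ⟨V, hV, -⟩ := exists_compactOpens X isOpen_univ (Set.mem_univ x)
    exact germ_eq_zero.2 ⟨V, hV, I.mul_mem_left _ _ (I.mul_mem_right _ _ h)⟩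
  · intro h
    obtain ⟨W, hW, hfW⟩ := exists_compactOpens_idem_mul f
    have key : ∃ V : CompactOpens X, (W : Set X) ⊆ V ∧ idem V * f ∈ I := by
      refine W.isCompact.induction_on (p := fun S => ∃ V : CompactOpens X, S ⊆ V ∧ idem V * f ∈ I)
        ?_ ?_ ?_ ?_
      · refine ⟨⊥, Set.empty_subset _, ?_⟩
        have : (idem ⊥ * f : O.ConvAlg) = 0 := Subtype.ext (funext fun g => by
          rw [idem_mul_apply]
          exact if_neg fun h => h)
        rw [this]
        exact I.zero_mem
      · rintro S T hST ⟨V, hV, hVf⟩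
        exact ⟨V, hST.trans hV, hVf⟩
      · rintro S T ⟨V, hV, hVf⟩ ⟨V', hV', hVf'⟩
        refine ⟨V ⊔ V', Set.union_subset_union hV hV', ?_⟩
        rw [idem_sup_mul]
        exact I.sub_mem (I.add_mem hVf hVf') (I.mul_mem_left _ _ hVf')
      · intro x _
        obtain ⟨V, hxV, hV⟩ := germ_eq_zero.1 (h (idem W) x)
        rw [hfW] at hV
        exact ⟨V, mem_nhdsWithin_of_mem_nhds (V.isOpen.mem_nhds hxV), V, subset_rfl, hV⟩
    obtain ⟨V, hWV, hV⟩ := key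
    rwa [hW V hWV] at hV

/-- A bisection carries neighbourhoods of d(γ) to neighbourhoods of r(γ): with V' = r(U ∩ d⁻¹(V))
one has 1_{V'} f = f 1_V, so 1_V a ∈ I gives 1_{V'} f a ∈ I. -/
theorem germ_mul_eq_zero {f : O.Fn} {U : Set (Arr X)} (hf : IsSupportedOn f U) {x y : X}
    {γ : x ⟶ y} (hγ : (⟨x, y, γ⟩ : Arr X) ∈ U) {a : O.ConvAlg} (ha : germ I x a = 0) :
    germ I y ((⟨f, hf.mem⟩ : O.ConvAlg) * a) = 0 := by
  obtain ⟨V, hxV, hV⟩ := germ_eq_zero.1 ha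
  have hUV : IsCompactOpenBisection (U ∩ Arr.dom ⁻¹' V) :=
    { isCompact := hf.bisection.isCompact.inter_right
        ((isClosed_compactOpens X V).preimage continuous_dom)
      isOpen := hf.bisection.isOpen.inter (V.isOpen.preimage continuous_dom)
      injOn_dom := hf.bisection.injOn_dom.mono Set.inter_subset_left
      injOn_rng := hf.bisection.injOn_rng.mono Set.inter_subset_left }
  obtain ⟨V', hV'⟩ := hUV.exists_rng_image
  have hmem : ∀ {z : X}, z ∈ V' ↔ z ∈ Arr.rng '' (U ∩ Arr.dom ⁻¹' V) := fun {z} => by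
    rw [← hV']; rfl
  refine germ_eq_zero.2 ⟨V', hmem.2 ⟨_, ⟨hγ, hxV⟩, rfl⟩, ?_⟩
  have h : idem V' * (⟨f, hf.mem⟩ : O.ConvAlg) = ⟨f, hf.mem⟩ * idem V := by
    classical
    refine Subtype.ext (funext fun g => ?_)
    rw [idem_mul_apply, mul_idem_apply]
    by_cases hg : g ∈ U
    · refine if_congr (hmem.trans ⟨?_, fun h => ⟨g, ⟨hg, h⟩, rfl⟩⟩) rfl rfl
      rintro ⟨g', ⟨hg', hV⟩, hr⟩
      rwa [hf.bisection.injOn_rng hg' hg hr] at hV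
    · rw [show (⟨f, hf.mem⟩ : O.ConvAlg).1 g = 0 from hf.eq_zero g hg, ite_self, ite_self]
  rw [← mul_assoc, h, mul_assoc]
  exact I.mul_mem_left _ _ hV

/-- Two continuous lifts into an étale space that agree at γ agree near γ, so f and f' coincide over
a neighbourhood of r(γ). Hence only the value at γ matters. -/
theorem germ_mul_congr {f f' : O.Fn} {U U' : Set (Arr X)} (hf : IsSupportedOn f U)
    (hf' : IsSupportedOn f' U') {x y : X} {γ : x ⟶ y} (hγ : (⟨x, y, γ⟩ : Arr X) ∈ U)
    (hγ' : (⟨x, y, γ⟩ : Arr X) ∈ U') (h : ev f γ = ev f' γ) (a : O.ConvAlg) :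
    germ I y ((⟨f, hf.mem⟩ : O.ConvAlg) * a) = germ I y ((⟨f', hf'.mem⟩ : O.ConvAlg) * a) := by
  have hU := hf.bisection.isOpen.mem_nhds hγ
  have hU' := hf'.bisection.isOpen.mem_nhds hγ'
  have hev := eventuallyEq_of_base_eq O.isLocalHomeomorph_base (hf.continuousOn.continuousAt hU)
    (hf'.continuousOn.continuousAt hU') (fun _ => rfl)
    (congrArg (fun c => (⟨y, c⟩ : Tot O.stalk)) h)
  obtain ⟨W, hW, hWo, hγW⟩ := mem_nhds_iff.1 hev
  obtain ⟨V, hyV, hV⟩ := exists_compactOpens X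
    (AmpleGroupoid.isLocalHomeomorph_rng.isOpenMap _
      ((hWo.inter hf.bisection.isOpen).inter hf'.bisection.isOpen))
    ⟨_, ⟨⟨hγW, hγ⟩, hγ'⟩, rfl⟩
  refine germ_eq_of_idem_mul_eq hyV ?_
  rw [← mul_assoc, ← mul_assoc]
  congr 1
  classical
  refine Subtype.ext (funext fun g => ?_)
  rw [idem_mul_apply, idem_mul_apply]
  refine ite_congr rfl (fun hg => ?_) fun _ => rfl
  obtain ⟨g', ⟨⟨hg'W, hg'U⟩, hg'U'⟩, hr⟩ := hV hg
  -- Over V there is an arrow g' in both bisections at which f and f' agree. Injectivity of r forces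
  -- an arrow of either bisection with the same range to be g'; elsewhere both functions vanish.
  by_cases hgU : g ∈ U ∨ g ∈ U'
  · have hgg : g' = g := hgU.elim (fun h => hf.bisection.injOn_rng hg'U h hr)
      fun h => hf'.bisection.injOn_rng hg'U' h hr
    subst hgg
    have := hW hg'W
    simpa using this
  · rw [not_or] at hgU
    exact (hf.eq_zero g hgU.1).trans (hf'.eq_zero g hgU.2).symm

theorem exists_isSupportedOn {x y : X} (γ : x ⟶ y) {U : Set (Arr X)}
    (hU : IsCompactOpenBisection U) (hγ : (⟨x, y, γ⟩ : Arr X) ∈ U) (c : O.stalk y) :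
    ∃ s : ∀ x, O.stalk x, IsSupportedOn (bump U s) U ∧ ev (bump U s) γ = c := by
  obtain ⟨s, -, hs, hsy, -⟩ := exists_section X O.isLocalHomeomorph_base O.continuous_add c
    isOpen_univ (Set.mem_univ y)
  exact ⟨s, isSupportedOn_bump hU hs, (bump_of_mem s hγ).trans hsy⟩

variable (I) in
-- The rule is stated for every function on a bisection through γ with value c there, so later
-- arguments may pick whichever representative is convenient.
theorem exists_arrowAct {x y : X} (γ : x ⟶ y) (c : O.stalk y) :
    ∃ T : QuotStalk I x →+ QuotStalk I y, ∀ (f : O.Fn) (U : Set (Arr X)) (hf : IsSupportedOn f U),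
      (⟨x, y, γ⟩ : Arr X) ∈ U → ev f γ = c →
      ∀ a, T (germ I x a) = germ I y ((⟨f, hf.mem⟩ : O.ConvAlg) * a) := by
  obtain ⟨U, hU, hγ⟩ := exists_bisection (⟨x, y, γ⟩ : Arr X)
  obtain ⟨s, hs, hsc⟩ := exists_isSupportedOn γ hU hγ c
  refine ⟨QuotientAddGroup.lift _
    ((germ I y).comp (AddMonoidHom.mulLeft (⟨bump U s, hs.mem⟩ : O.ConvAlg)))
    fun a ha => germ_mul_eq_zero hs hγ (germ_eq_zero.2 ha), fun f U' hf hγ' hfc a => ?_⟩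
  exact germ_mul_congr hs hf hγ hγ' (hsc.trans hfc.symm) a

variable (I) in
/-- The action of `c 1_γ` on the stalks of the quotient by `I`. -/
noncomputable def arrowAct {x y : X} (γ : x ⟶ y) (c : O.stalk y) :
    QuotStalk I x →+ QuotStalk I y :=
  (exists_arrowAct I γ c).choose

theorem arrowAct_germ {f : O.Fn} {U : Set (Arr X)} (hf : IsSupportedOn f U) {x y : X} {γ : x ⟶ y}
    (hγ : (⟨x, y, γ⟩ : Arr X) ∈ U) (a : O.ConvAlg) :
    arrowAct I γ (ev f γ) (germ I x a) = germ I y ((⟨f, hf.mem⟩ : O.ConvAlg) * a) :=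
  (exists_arrowAct I γ (ev f γ)).choose_spec f U hf hγ rfl a

/-- Both coefficients are represented on one bisection, so that the sum is again supported on a
bisection. -/
theorem arrowAct_add {x y : X} (γ : x ⟶ y) (c c' : O.stalk y) :
    arrowAct I γ (c + c') = arrowAct I γ c + arrowAct I γ c' := by
  refine AddMonoidHom.ext fun n => ?_
  obtain ⟨a, rfl⟩ := germ_surjective x n
  obtain ⟨U, hU, hγ⟩ := exists_bisection (⟨x, y, γ⟩ : Arr X)
  obtain ⟨s, hs, hsc⟩ := exists_isSupportedOn γ hU hγ c
  obtain ⟨t, ht, htc⟩ := exists_isSupportedOn γ hU hγ c'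
  have hst : IsSupportedOn (bump U s + bump U t) U := by
    refine ⟨hU, ?_, fun g hg => ?_⟩
    · exact O.continuous_add.comp_continuousOn
        (f := fun g : Arr X => (⟨g.rng, bump U s g, bump U t g⟩ : FibProd O.stalk O.stalk))
        ((IsInducing.continuousOn_iff (g := FibProd.toProd) ⟨rfl⟩).2
          (hs.continuousOn.prodMk ht.continuousOn))
    · rw [Pi.add_apply, hs.eq_zero g hg, ht.eq_zero g hg, add_zero]
  have h := arrowAct_germ (I := I) hst hγ a
  have hsum : ev (bump U s + bump U t) γ = c + c' := by
    rw [← hsc, ← htc]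
    rfl
  rw [hsum] at h
  rw [AddMonoidHom.add_apply, h, ← hsc, ← htc, arrowAct_germ hs hγ, arrowAct_germ ht hγ,
    ← map_add, ← add_mul]
  rfl

theorem arrowAct_zero {x y : X} (γ : x ⟶ y) : arrowAct I γ (0 : O.stalk y) = 0 := by
  have h := arrowAct_add (I := I) γ (0 : O.stalk y) 0
  rwa [add_zero, left_eq_add] at h

/-- The convolution of two representatives lives on the product bisection and has value bα_β(c) at
βγ. Associativity of the stalk modules, functoriality and semilinearity are all special cases. -/
theorem arrowAct_comp {x y z : X} (γ : x ⟶ y) (β : y ⟶ z) (c : O.stalk y) (b : O.stalk z)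
    (n : QuotStalk I x) :
    arrowAct I β b (arrowAct I γ c n) = arrowAct I (γ ≫ β) (b * O.act β c) n := by
  obtain ⟨a, rfl⟩ := germ_surjective x n
  obtain ⟨U, hU, hγ⟩ := exists_bisection (⟨x, y, γ⟩ : Arr X)
  obtain ⟨V, hV, hβ⟩ := exists_bisection (⟨y, z, β⟩ : Arr X)
  obtain ⟨s, hs, rfl⟩ := exists_isSupportedOn γ hU hγ c
  obtain ⟨t, ht, rfl⟩ := exists_isSupportedOn β hV hβ b
  have h := arrowAct_germ (I := I) (ht.conv hs) (γ := γ ≫ β) ⟨⟨γ, β⟩, ⟨hγ, hβ⟩, rfl⟩ a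
  rw [conv_comp_apply ht ⟨γ, β⟩ hβ] at h
  rw [h, arrowAct_germ hs hγ, arrowAct_germ ht hβ, ← mul_assoc]
  rfl

theorem arrowAct_id (x : X) (n : QuotStalk I x) : arrowAct I (𝟙 x) (1 : O.stalk x) n = n := by
  obtain ⟨a, rfl⟩ := germ_surjective x n
  obtain ⟨V, hV, -⟩ := exists_compactOpens X isOpen_univ (Set.mem_univ x)
  have h := arrowAct_germ (I := I) (isSupportedOn_idem (O := O) V) (γ := 𝟙 x) ⟨x, hV, rfl⟩ a
  rw [idem_apply_unit, if_pos hV] at h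
  exact h.trans (germ_idem_mul hV a)

noncomputable instance (x : X) : Module (O.stalk x) (QuotStalk I x) where
  smul c n := arrowAct I (𝟙 x) c n
  one_smul n := arrowAct_id x n
  mul_smul c d n := by
    change _ = arrowAct I (𝟙 x) c (arrowAct I (𝟙 x) d n)
    rw [arrowAct_comp, Category.comp_id, O.act_id]
    rfl
  smul_zero c := map_zero _
  smul_add c := map_add _
  add_smul c d n := by
    change arrowAct I (𝟙 x) (c + d) n = _
    rw [arrowAct_add]
    rfl
  zero_smul n := by
    change arrowAct I (𝟙 x) 0 n = _
    rw [arrowAct_zero]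
    rfl

theorem stalk_smul_def {x : X} (c : O.stalk x) (n : QuotStalk I x) :
    c • n = arrowAct I (𝟙 x) c n := rfl

variable (I) in
/-- The action of the arrows on the stalks of the quotient by `I`. -/
noncomputable def quotAction : StalkAction O (QuotStalk I) where
  act γ := arrowAct I γ 1
  act_id := arrowAct_id
  act_comp γ β n := by rw [arrowAct_comp, map_one, one_mul]
  act_smul γ c n := by
    rw [stalk_smul_def, stalk_smul_def, arrowAct_comp, arrowAct_comp, Category.comp_id,
      Category.id_comp, map_one, one_mul, mul_one]

theorem smul_quotAction_act {x y : X} (γ : x ⟶ y) (c : O.stalk y) (n : QuotStalk I x) :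
    c • (quotAction I).act γ n = arrowAct I γ c n := by
  change arrowAct I (𝟙 y) c (arrowAct I γ 1 n) = _
  rw [arrowAct_comp, map_one, mul_one, Category.comp_id]

/-- Germ families behave like sections. By additivity f lives on a bisection, and at most one of its
arrows ends at z; for that arrow the formula is the definition of the action. -/
theorem germ_mul (f a : O.ConvAlg) (z : X) :
    germ I z (f * a) = (quotAction I).sumAct f (fun x => germ I x a) z := by
  rw [StalkAction.sumAct_apply]
  have hfin : ∀ f : O.ConvAlg, (Function.support fun β : RFib z =>
      ev f.1 β.2 • (quotAction I).act β.2 (germ I β.1 a)).Finite := fun f =>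
    (quotAction I).sumAct_finite f.2 (fun x => germ I x a) z
  obtain ⟨f, hf⟩ := f
  induction hf using AddSubgroup.closure_induction with
  | mem f h =>
    obtain ⟨U, hU⟩ := h
    by_cases hz : ∃ g ∈ U, g.rng = z
    · obtain ⟨⟨x, z', γ⟩, hg, h⟩ := hz
      change z' = z at h
      subst h
      rw [finsum_eq_single _ (⟨x, γ⟩ : RFib z'), smul_quotAction_act, arrowAct_germ hU hg]
      rintro ⟨y, β⟩ hβ
      have h0 : ev f β = 0 := hU.eq_zero _ fun hn => by
        cases hU.bisection.injOn_rng hn hg rfl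
        exact hβ rfl
      change ev f β • _ = _
      rw [h0, zero_smul]
    · rw [finsum_eq_zero_of_forall_eq_zero]
      -- The set r(U) is compact, hence closed, so when z lies outside it f vanishes over a whole
      -- neighbourhood of z.
      · obtain ⟨W, hW⟩ := hU.bisection.exists_rng_image
        obtain ⟨V, hzV, hV⟩ := exists_compactOpens X (isClosed_compactOpens X W).isOpen_compl
          (show z ∈ (W : Set X)ᶜ by rw [hW]; exact hz)
        have hfV : idem V * (⟨f, hU.mem⟩ : O.ConvAlg) = 0 := by
          refine Subtype.ext (funext fun g => ?_)
          rw [idem_mul_apply]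
          split_ifs with hg
          · exact hU.eq_zero g fun hgU => hV hg (hW ▸ Set.mem_image_of_mem _ hgU)
          · rfl
        rw [← germ_idem_mul hzV, ← mul_assoc]
        change germ I z (idem V * (⟨f, hU.mem⟩ : O.ConvAlg) * a) = 0
        rw [hfV, zero_mul, map_zero]
      · rintro ⟨y, β⟩
        have h0 : ev f β = 0 := hU.eq_zero _ fun hn => hz ⟨_, hn, rfl⟩
        change ev f β • _ = _
        rw [h0, zero_smul]
  | zero =>
    change germ I z ((0 : O.ConvAlg) * a) = _
    rw [zero_mul, map_zero, finsum_eq_zero_of_forall_eq_zero]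
    exact fun β => zero_smul _ _
  | add f f' hf hf' h h' =>
    change germ I z (((⟨f, hf⟩ : O.ConvAlg) + ⟨f', hf'⟩) * a) = _
    rw [add_mul, map_add, h, h', ← finsum_add_distrib (hfin ⟨f, hf⟩) (hfin ⟨f', hf'⟩)]
    exact finsum_congr fun β => (add_smul _ _ _).symm
  | neg f hf h =>
    change germ I z (-(⟨f, hf⟩ : O.ConvAlg) * a) = _
    rw [neg_mul, map_neg, h, ← finsum_neg_distrib]
    exact finsum_congr fun β => (neg_smul _ _).symm

/-- Interpolation for germ families: multiplying a representative by 1_V, with V a neighbourhood of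
y missing F, keeps the germ at y and kills those on F, since V is closed. -/
theorem exists_germ_eq (y : X) (n : QuotStalk I y) (F : Finset X) (hy : y ∉ F) :
    ∃ s ∈ Set.range fun (a : O.ConvAlg) (x : X) => germ I x a, s y = n ∧ ∀ x ∈ F, s x = 0 := by
  have : T2Space X := AmpleGroupoid.t2Space
  obtain ⟨a, rfl⟩ := germ_surjective y n
  obtain ⟨V, hyV, hV⟩ := exists_compactOpens X (F.finite_toSet.isClosed.isOpen_compl)
    (show y ∈ (F : Set X)ᶜ by simpa using hy)
  refine ⟨_, ⟨idem V * a, rfl⟩, germ_idem_mul hyV a, fun x hx => ?_⟩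
  obtain ⟨W, hxW, hW⟩ := exists_compactOpens X (isClosed_compactOpens X V).isOpen_compl
    (show x ∈ (V : Set X)ᶜ from fun h => hV h hx)
  refine germ_eq_zero_of_vanishing hxW fun g hg => ?_
  rw [idem_mul_apply]
  exact if_neg (hW hg)

noncomputable instance (x : X) : Module (O.Isot x) (QuotStalk I x) :=
  Module.compHom (QuotStalk I x) ((quotAction I).isotRep x)

variable (I) in
-- The criterion applied to the set of germ families; by `germ_mul`, killing them all is the local
-- form of membership in I.
theorem eq_iInf_ann_quotStalk : I = ⨅ x : X, Ann (O.indRep x (QuotStalk I x)) := by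
  refine SetLike.ext fun f => ?_
  rw [(quotAction I).mem_iInf_ann_indRep (fun x δ c n => (quotAction I).isotRep_single x δ c n) _
    exists_germ_eq, mem_iff_germ_mul, Set.forall_mem_range]
  refine forall_congr' fun a => ?_
  rw [funext_iff]
  exact forall_congr' fun z => by rw [germ_mul]; rfl

end IdealGerms

end SheafGroupoid

theorem mainTheorem2 {X : Type u} [Groupoid.{w} X] [TopologicalSpace X]
    [TopologicalSpace (SheafGroupoid.Arr X)] [SheafGroupoid.AmpleGroupoid X]
    (O : SheafGroupoid.RingSheaf.{u, w, v} X) :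
    (∀ M : SheafGroupoid.ModSheaf.{u, w, v, v'} O,
      SheafGroupoid.Ann M.sectionRep = ⨅ x : X, SheafGroupoid.Ann (O.indRep x (M.stalk x))) ∧
    ∀ I : TwoSidedIdeal O.ConvAlg,
      ∃ (N : X → Type (max u w v)) (_ : ∀ x, AddCommGroup (N x))
        (_ : ∀ x, Module (O.Isot x) (N x)),
        I = ⨅ x : X, SheafGroupoid.Ann (O.indRep x (N x)) :=
  ⟨fun M => M.ann_sectionRep, fun I => ⟨fun x => SheafGroupoid.QuotStalk I x,
    fun _ => inferInstance, fun _ => inferInstance, SheafGroupoid.eq_iInf_ann_quotStalk I⟩⟩
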